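/- Let $q=e^{2\pi i\tau}$, let prime denote $q\,\frac{d}{dq}=\frac1{2\pi i}\frac{d}{d\tau}$, and for $\operatorname{Im}\tau>0$ let $$E_{1,3}(\tau)=\sum_{(\alpha,\beta)\in\mathbb Z^2}q^{\alpha^2-\alpha\beta+\beta^2}.$$ For a function $f(\tau)$ put $$I_1=\frac{ff''-2f'^2}{f^6},\quad J_1=\frac{f^2f'''-9ff'f''+12f'^3}{f^9}\quad(f\ne0),$$ $$P_1=\frac{(f^2f'''-9ff'f''+12f'^3)^2}{(ff''-2f'^2)^3},\quad Q_1=\frac{f^2\,(2ff''''-32f'f'''+36f''^2)}{(ff''-2f'^2)^2}\quad(ff''-2f'^2\neq0).$$ Let $G_1$ (resp. $\mathcal G_1$) be the group of point transformations $\tilde\tau=\frac{a\tau+b}{c\tau+d}$, $\tilde f=(c\tau+d)f$ with $\begin{pmatrix}a&b\\c&d\end{pmatrix}\in \mathrm{SL}(2,\mathbb R)$ (resp. $\mathrm{GL}(2,\mathbb R)$). An ODE is called invariant under the group if, for every open $U\subset\mathbb C$ on which $c\tau+d$ has no zero, $f$ is a holomorphic solution on $U$ if and only if $\tilde f$ is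 a holomorphic solution on the image of $U$. (i) The series $E_{1,3}$ converges absolutely on the upper half-plane, and there are holomorphic functions $M,N$ there such that $f=E_{1,3}$ satisfies Huber's system $$f'=\frac{Mf-N}3,\qquad M'=\frac{M^2-Nf}3,\qquad N'=(M-f^2)N. \tag{H}$$ (ii) Whenever holomorphic functions $f,M,N$ on an open set $U\subset\mathbb C$ satisfy (H), $f$ satisfies on $U$ the third-order ODE $$f^2f'''^2-6f'(3ff''-4f'^2)f'''+18ff''^3-(f^6+27f'^2)f''^2+4f^5f'^2f''-4f^4f'^4=0. \tag{A}$$ In particular $f=E_{1,3}$ satisfies (A) on the upper half-plane. Equation (A) is $G_1$-invariant, and where $f\ne0$ it is equivalent to $J_1^2+18I_1^3-I_1^2=0$; this relation therefore holds for $E_{1,3}$ wherever $E_{1,3}\neq0$. (iii) The fourth-order ODE $$ff''''(ff''-2f'^2)-f^2f'''^2+2f'(ff''+4f'^2)f'''-9f'^2f''^2=0 \tag{B}$$ is a differential consequence of (A): every holomorphic solution $f$ of (A) on a connected open set $U\subset\mathbb C$, other than the singular solutions (those with $I_1=\frac1{18}$ at all points of $U$ where $f\ne0$), satisfies (B) on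 $U$. Moreover $f=E_{1,3}$ satisfies (B) on the upper half-plane. Equation (B) is $\mathcal G_1$-invariant, and where $f\ne0$ and $ff''-2f'^2\ne0$ it is equivalent to $Q_1-2P_1-36=0$. For $f=E_{1,3}$ one has $ff''-2f'^2\neq0$ and $Q_1-2P_1-36=0$ at every point of the upper half-plane. -/

import Mathlib

open UpperHalfPlane (upperHalfPlaneSet)

/-- The derivation `' = (1 / (2πi)) d/dτ = q d/dq`, where `q = exp (2πiτ)`. -/
noncomputable def qDeriv (f : ℂ → ℂ) (τ : ℂ) : ℂ :=
  (2 * Real.pi * Complex.I)⁻¹ * deriv f τ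

/-- The jet `(f, f', f'', f''', …)` of `f` at `τ`; primes are iterates of `qDeriv`. -/
noncomputable def qJet (f : ℂ → ℂ) (τ : ℂ) : ℕ → ℂ :=
  fun n => (qDeriv^[n] f) τ

/-- The Eisenstein series
`E_{1,3}(τ) = ∑_{(α,β) ∈ ℤ²} q^(α² - αβ + β²)`, `q = exp (2πiτ)`, for `Im τ > 0`. -/
noncomputable def E13 (τ : ℂ) : ℂ :=
  ∑' p : ℤ × ℤ,
    Complex.exp (2 * Real.pi * Complex.I * τ * ((p.1 ^ 2 - p.1 * p.2 + p.2 ^ 2 : ℤ) : ℂ))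

/-- `f` is a holomorphic solution on `U` of the ODE `F(f, f', f'', …) = 0`. An ODE is given by its
left-hand side, a function of the jet variables `y 0 = f, y 1 = f', y 2 = f'', …`. -/
def IsSolutionOn (F : (ℕ → ℂ) → ℂ) (f : ℂ → ℂ) (U : Set ℂ) : Prop :=
  DifferentiableOn ℂ f U ∧ ∀ τ ∈ U, F (qJet f τ) = 0

/-- Huber's system for three holomorphic functions `f, M, N` on `U`. -/
def IsHuberSolutionOn (f M N : ℂ → ℂ) (U : Set ℂ) : Prop :=
  DifferentiableOn ℂ f U ∧ DifferentiableOn ℂ M U ∧ DifferentiableOn ℂ N U ∧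
  ∀ τ ∈ U,
    qDeriv f τ = (M τ * f τ - N τ) / 3 ∧
    qDeriv M τ = (M τ ^ 2 - N τ * f τ) / 3 ∧
    qDeriv N τ = (M τ - f τ ^ 2) * N τ

/-- Left-hand side of the third-order ODE
`f²f'''² - 6f'(3ff'' - 4f'²)f''' + 18ff''³ - (f⁶ + 27f'²)f''² + 4f⁵f'²f'' - 4f⁴f'⁴ = 0`. -/
def ode3 (y : ℕ → ℂ) : ℂ :=
  y 0 ^ 2 * y 3 ^ 2 - 6 * y 1 * (3 * y 0 * y 2 - 4 * y 1 ^ 2) * y 3 + 18 * y 0 * y 2 ^ 3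
    - (y 0 ^ 6 + 27 * y 1 ^ 2) * y 2 ^ 2 + 4 * y 0 ^ 5 * y 1 ^ 2 * y 2 - 4 * y 0 ^ 4 * y 1 ^ 4

/-- Left-hand side of the fourth-order ODE
`ff''''(ff'' - 2f'²) - f²f'''² + 2f'(ff'' + 4f'²)f''' - 9f'²f''² = 0`. -/
def ode4 (y : ℕ → ℂ) : ℂ :=
  y 0 * y 4 * (y 0 * y 2 - 2 * y 1 ^ 2) - y 0 ^ 2 * y 3 ^ 2
    + 2 * y 1 * (y 0 * y 2 + 4 * y 1 ^ 2) * y 3 - 9 * y 1 ^ 2 * y 2 ^ 2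

/-- `kff'' - (k+1)f'²`. -/
def bracketTwo (k : ℂ) (y : ℕ → ℂ) : ℂ :=
  k * y 0 * y 2 - (k + 1) * y 1 ^ 2

/-- `k²f²f''' - 3k(k+2)ff'f'' + 2(k+1)(k+2)f'³`. -/
def bracketThree (k : ℂ) (y : ℕ → ℂ) : ℂ :=
  k ^ 2 * y 0 ^ 2 * y 3 - 3 * k * (k + 2) * y 0 * y 1 * y 2 + 2 * (k + 1) * (k + 2) * y 1 ^ 3

/-- The differential invariant `I_k`, meaningful for `k ≠ 0` where `f ≠ 0`. -/
noncomputable def invI (k : ℂ) (y : ℕ → ℂ) : ℂ :=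
  bracketTwo k y / y 0 ^ (2 + 4 / k)

/-- The differential invariant `J_k`, meaningful for `k ≠ 0` where `f ≠ 0`. -/
noncomputable def invJ (k : ℂ) (y : ℕ → ℂ) : ℂ :=
  bracketThree k y / y 0 ^ (3 + 6 / k)

/-- The differential invariant `P_k`, meaningful where `kff'' - (k+1)f'² ≠ 0`. -/
noncomputable def invP (k : ℂ) (y : ℕ → ℂ) : ℂ :=
  bracketThree k y ^ 2 / bracketTwo k y ^ 3

/-- The differential invariant `Q_k`, meaningful where `kff'' - (k+1)f'² ≠ 0`. -/
noncomputable def invQ (k : ℂ) (y : ℕ → ℂ) : ℂ :=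
  y 0 ^ 2 * (k * (k + 1) * y 0 * y 4 - 4 * (k + 1) * (k + 3) * y 1 * y 3
    + 3 * (k + 2) * (k + 3) * y 2 ^ 2) / bracketTwo k y ^ 2

/-- `cτ + d` for the real matrix `A = (a b; c d)`. -/
def autFactor (A : Matrix (Fin 2) (Fin 2) ℝ) (τ : ℂ) : ℂ :=
  (A 1 0 : ℂ) * τ + (A 1 1 : ℂ)

/-- `(aτ + b) / (cτ + d)` for the real matrix `A = (a b; c d)`. -/
noncomputable def moebius (A : Matrix (Fin 2) (Fin 2) ℝ) (τ : ℂ) : ℂ :=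
  ((A 0 0 : ℂ) * τ + (A 0 1 : ℂ)) / autFactor A τ

/-- The ODE `F = 0` is invariant under the point transformations
`τ̃ = (aτ + b)/(cτ + d)`, `f̃ = (cτ + d)^k f` with `(a b; c d) ∈ S`: a function `f` on an open set
`U` on which `cτ + d` does not vanish is a solution if and only if the transformed function `f̃` is
a solution on the image of `U`. -/
def IsInvariantODE (k : ℤ) (S : Set (Matrix (Fin 2) (Fin 2) ℝ)) (F : (ℕ → ℂ) → ℂ) : Prop :=
  ∀ A ∈ S, ∀ U : Set ℂ, IsOpen U → (∀ τ ∈ U, autFactor A τ ≠ 0) →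
    ∀ f g : ℂ → ℂ, (∀ τ ∈ U, g (moebius A τ) = autFactor A τ ^ k * f τ) →
      (IsSolutionOn F f U ↔ IsSolutionOn F g (moebius A '' U))

/-!
Under a point transformation of determinant one the left-hand side of (A) is multiplied by a power
of `cτ + d`, and that of (B), under any of them, by such a power and a power of the determinant;
hence the invariance. Differentiating (A) and eliminating gives (B) multiplied by
`C = f²f''' - 9ff'f'' + 12f'³`. If `C` vanishes identically on a non-singular solution, then so does
`B = ff'' - 2f'²`, and `B = C = 0` implies (B).

For `f = E13`, Poisson summation gives the Fricke transformation law `τ ↦ -1 / (3τ)` of weight one,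
hence those of `B` and of (A). A holomorphic function of `q` in the unit disc whose norm is
invariant under `τ ↦ -1 / (Nτ)` with `N < 4` is constant: modulo `τ ↦ τ + 1` the involution moves
every point of a circle `|q| = r` with `r` near `1` to a smaller `|q|`, so the maximum of the norm
over `|q| ≤ r` is attained inside. Applied to `B⁴ / (Δ(τ) Δ(3τ))` this shows that `B` has no zero;
applied to the quotient of `f²` times the left-hand side of (A) by `B³`, which vanishes at the cusp,
it proves (A). Finally, in Huber's system `L = f³ - N` satisfies `L' = M L` and `N - L = C / B`,
which recovers `M` and `N` from any solution of (A) on which `B` has no zero and `C` is not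
identically zero.
-/

open Set Filter Topology

/-- `f` has derivative `a` at `τ` with respect to the derivation `(1 / (2πi)) d/dτ`. -/
def HasQDerivAt (f : ℂ → ℂ) (a τ : ℂ) : Prop :=
  HasDerivAt f (2 * Real.pi * Complex.I * a) τ

namespace HasQDerivAt

variable {f g : ℂ → ℂ} {a b τ : ℂ}

theorem qDeriv_eq (h : HasQDerivAt f a τ) : qDeriv f τ = a := by
  rw [qDeriv, HasDerivAt.deriv h, inv_mul_cancel_left₀ Complex.two_pi_I_ne_zero]

theorem of_differentiableAt (h : DifferentiableAt ℂ f τ) : HasQDerivAt f (qDeriv f τ) τ := by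
  rw [HasQDerivAt, qDeriv, mul_inv_cancel_left₀ Complex.two_pi_I_ne_zero]
  exact h.hasDerivAt

theorem differentiableAt (h : HasQDerivAt f a τ) : DifferentiableAt ℂ f τ :=
  HasDerivAt.differentiableAt h

theorem unique (h : HasQDerivAt f a τ) (h' : HasQDerivAt f b τ) : a = b :=
  h.qDeriv_eq.symm.trans h'.qDeriv_eq

theorem congr_deriv (h : HasQDerivAt f a τ) (hab : a = b) : HasQDerivAt f b τ := hab ▸ h

theorem const (c τ : ℂ) : HasQDerivAt (fun _ => c) 0 τ :=
  (hasDerivAt_const τ c).congr_deriv (mul_zero _).symm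

theorem add (hf : HasQDerivAt f a τ) (hg : HasQDerivAt g b τ) :
    HasQDerivAt (fun t => f t + g t) (a + b) τ :=
  (HasDerivAt.fun_add hf hg).congr_deriv (by ring)

theorem sub (hf : HasQDerivAt f a τ) (hg : HasQDerivAt g b τ) :
    HasQDerivAt (fun t => f t - g t) (a - b) τ :=
  (HasDerivAt.fun_sub hf hg).congr_deriv (by ring)

theorem sum {ι : Type*} {s : Finset ι} {F : ι → ℂ → ℂ} {d : ι → ℂ}
    (h : ∀ i ∈ s, HasQDerivAt (F i) (d i) τ) :
    HasQDerivAt (fun t => ∑ i ∈ s, F i t) (∑ i ∈ s, d i) τ :=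
  (HasDerivAt.fun_sum h).congr_deriv (Finset.mul_sum ..).symm

theorem mul (hf : HasQDerivAt f a τ) (hg : HasQDerivAt g b τ) :
    HasQDerivAt (fun t => f t * g t) (a * g τ + f τ * b) τ :=
  (HasDerivAt.fun_mul hf hg).congr_deriv (by ring)

theorem const_mul (c : ℂ) (hf : HasQDerivAt f a τ) :
    HasQDerivAt (fun t => c * f t) (c * a) τ :=
  (HasDerivAt.const_mul c hf).congr_deriv (by ring)

theorem div_const (hf : HasQDerivAt f a τ) (c : ℂ) :
    HasQDerivAt (fun t => f t / c) (a / c) τ :=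
  (HasDerivAt.div_const hf c).congr_deriv (by ring)

theorem pow (hf : HasQDerivAt f a τ) (n : ℕ) :
    HasQDerivAt (fun t => f t ^ n) (n * f τ ^ (n - 1) * a) τ :=
  (HasDerivAt.fun_pow hf n).congr_deriv (by ring)

theorem zpow (hf : HasQDerivAt f a τ) (m : ℤ) (h : f τ ≠ 0) :
    HasQDerivAt (fun t => f t ^ m) (m * f τ ^ (m - 1) * a) τ :=
  ((hasDerivAt_zpow m (f τ) (.inl h)).comp τ hf).congr_deriv (by ring)

theorem congr_of_eqOn {U : Set ℂ} (hf : HasQDerivAt f a τ) (hU : IsOpen U) (hτ : τ ∈ U)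
    (h : EqOn g f U) : HasQDerivAt g a τ :=
  HasDerivAt.congr_of_eventuallyEq hf (h.eventuallyEq_of_mem (hU.mem_nhds hτ))

end HasQDerivAt

section Jets

variable {f g : ℂ → ℂ} {U : Set ℂ} {τ : ℂ}

theorem differentiableOn_qDeriv (h : DifferentiableOn ℂ f U) (hU : IsOpen U) :
    DifferentiableOn ℂ (qDeriv f) U :=
  (h.deriv hU).const_mul _

theorem qJet_zero (f : ℂ → ℂ) (τ : ℂ) : qJet f τ 0 = f τ := rfl

theorem qJet_one (f : ℂ → ℂ) (τ : ℂ) : qJet f τ 1 = qDeriv f τ := rfl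

theorem qJet_succ (f : ℂ → ℂ) (τ : ℂ) (n : ℕ) :
    qJet f τ (n + 1) = qDeriv (fun t => qJet f t n) τ := by
  simp only [qJet, Function.iterate_succ_apply']

theorem differentiableOn_qJet (h : DifferentiableOn ℂ f U) (hU : IsOpen U) (n : ℕ) :
    DifferentiableOn ℂ (fun t => qJet f t n) U := by
  induction n with
  | zero => exact h
  | succ n ih => simpa only [qJet_succ] using differentiableOn_qDeriv ih hU

theorem hasQDerivAt_qJet (h : DifferentiableOn ℂ f U) (hU : IsOpen U) (hτ : τ ∈ U) (n : ℕ) :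
    HasQDerivAt (fun t => qJet f t n) (qJet f τ (n + 1)) τ :=
  qJet_succ f τ n ▸
    .of_differentiableAt ((differentiableOn_qJet h hU n).differentiableAt (hU.mem_nhds hτ))

theorem qJet_succ_eqOn {n : ℕ} {F G : ℂ → ℂ} (hU : IsOpen U)
    (h : EqOn (fun t => qJet f t n) F U) (hF : ∀ τ ∈ U, HasQDerivAt F (G τ) τ) :
    EqOn (fun t => qJet f t (n + 1)) G U := fun τ hτ =>
  (qJet_succ f τ n).trans ((hF τ hτ).congr_of_eqOn hU hτ h).qDeriv_eq

theorem qJet_const_mul (hU : IsOpen U) (hf : DifferentiableOn ℂ f U) (c : ℂ) (n : ℕ) :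
    EqOn (fun t => qJet (fun s => c * f s) t n) (fun t => c * qJet f t n) U := by
  induction n with
  | zero => exact fun _ _ => rfl
  | succ n ih => exact qJet_succ_eqOn hU ih fun τ hτ => (hasQDerivAt_qJet hf hU hτ n).const_mul c

end Jets

section Algebra

variable {y : ℕ → ℂ}

theorem sq_mul_ode3 (y : ℕ → ℂ) :
    y 0 ^ 2 * ode3 y =
      bracketThree 1 y ^ 2 + 18 * bracketTwo 1 y ^ 3 - y 0 ^ 6 * bracketTwo 1 y ^ 2 := by
  simp only [ode3, bracketThree, bracketTwo]
  ring

theorem ode3_const_mul {c : ℂ} (hc : c ^ 4 = 1) (y : ℕ → ℂ) :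
    ode3 (fun n => c * y n) = ode3 y := by
  simp only [ode3]
  linear_combination (y 0 ^ 2 * y 3 ^ 2 - 6 * y 1 * (3 * y 0 * y 2 - 4 * y 1 ^ 2) * y 3
    + 18 * y 0 * y 2 ^ 3 - 27 * y 1 ^ 2 * y 2 ^ 2
    - (c ^ 4 + 1) * y 0 ^ 4 * (y 0 * y 2 - 2 * y 1 ^ 2) ^ 2) * hc

theorem invI_one (y : ℕ → ℂ) : invI 1 y = bracketTwo 1 y / y 0 ^ 6 := by
  rw [invI, ← Complex.cpow_natCast]
  norm_num

theorem invJ_one (y : ℕ → ℂ) : invJ 1 y = bracketThree 1 y / y 0 ^ 9 := by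
  rw [invJ, ← Complex.cpow_natCast]
  norm_num

theorem ode3_eq_zero_iff_invariants (h : y 0 ≠ 0) :
    ode3 y = 0 ↔ invJ 1 y ^ 2 + 18 * invI 1 y ^ 3 - invI 1 y ^ 2 = 0 := by
  have key : invJ 1 y ^ 2 + 18 * invI 1 y ^ 3 - invI 1 y ^ 2 = ode3 y / y 0 ^ 16 := by
    rw [invJ_one, invI_one, eq_div_iff (pow_ne_zero _ h)]
    field_simp
    linear_combination -sq_mul_ode3 y
  rw [key, div_eq_zero_iff, or_iff_left (pow_ne_zero _ h)]

theorem ode4_eq_zero_iff_invariants (h : y 0 ≠ 0) (hB : bracketTwo 1 y ≠ 0) :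
    ode4 y = 0 ↔ invQ 1 y - 2 * invP 1 y - 36 = 0 := by
  have key : invQ 1 y - 2 * invP 1 y - 36 = 2 * y 0 ^ 2 * ode4 y / bracketTwo 1 y ^ 3 := by
    rw [invQ, invP, eq_div_iff (pow_ne_zero _ hB)]
    field_simp
    simp only [ode4, bracketThree, bracketTwo]
    ring
  rw [key, div_eq_zero_iff, or_iff_left (pow_ne_zero _ hB), mul_eq_zero,
    or_iff_right (mul_ne_zero two_ne_zero (pow_ne_zero _ h))]

theorem invQ_sub_invP_eq_zero (hB : bracketTwo 1 y ≠ 0) (h : ode4 y = 0) :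
    invQ 1 y - 2 * invP 1 y - 36 = 0 := by
  by_cases h0 : y 0 = 0
  · have h1 : y 1 ≠ 0 := fun h1 => hB (by simp [bracketTwo, h0, h1])
    simp only [invQ, invP, bracketTwo, bracketThree, h0]
    field_simp
    ring
  · exact (ode4_eq_zero_iff_invariants h0 hB).1 h

theorem ode4_eq_zero_of_brackets_eq_zero (hB : bracketTwo 1 y = 0) (hC : bracketThree 1 y = 0) :
    ode4 y = 0 := by
  by_cases h0 : y 0 = 0
  · have h1 : y 1 = 0 := by simpa [bracketTwo, h0] using hB
    simp [ode4, h0, h1]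
  · have h2 : y 2 = 2 * y 1 ^ 2 / y 0 := by
      rw [bracketTwo] at hB
      rw [eq_div_iff h0]
      linear_combination hB
    have h3 : y 3 = 6 * y 1 ^ 3 / y 0 ^ 2 := by
      rw [bracketThree, h2] at hC
      field_simp at hC
      rw [eq_div_iff (pow_ne_zero 2 h0)]
      linear_combination hC
    rw [ode4, h2, h3]
    field_simp
    ring

end Algebra

section DifferentialConsequence

variable {f : ℂ → ℂ} {U : Set ℂ} {τ : ℂ}

theorem eqOn_zero_or_eqOn_zero_of_mul {g : ℂ → ℂ} (hU : IsOpen U) (hc : IsPreconnected U)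
    (hf : DifferentiableOn ℂ f U) (hg : DifferentiableOn ℂ g U)
    (h : ∀ τ ∈ U, f τ * g τ = 0) : (∀ τ ∈ U, f τ = 0) ∨ ∀ τ ∈ U, g τ = 0 :=
  (hf.analyticOnNhd hU).eq_zero_or_eq_zero_of_smul_eq_zero (hg.analyticOnNhd hU) h hc

theorem hasQDerivAt_bracketTwo (h : DifferentiableOn ℂ f U) (hU : IsOpen U) (hτ : τ ∈ U) :
    HasQDerivAt (fun t => bracketTwo 1 (qJet f t))
      (qJet f τ 0 * qJet f τ 3 - 3 * qJet f τ 1 * qJet f τ 2) τ := by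
  have d := hasQDerivAt_qJet h hU hτ
  exact ((((d 0).const_mul 1).mul (d 2)).sub (((d 1).pow 2).const_mul (1 + 1))).congr_deriv
    (by push_cast; ring)

theorem mul_qDeriv_bracketTwo (h : DifferentiableOn ℂ f U) (hU : IsOpen U) (hτ : τ ∈ U) :
    f τ * qDeriv (fun t => bracketTwo 1 (qJet f t)) τ =
      6 * qJet f τ 1 * bracketTwo 1 (qJet f τ) + bracketThree 1 (qJet f τ) := by
  rw [(hasQDerivAt_bracketTwo h hU hτ).qDeriv_eq]
  simp only [bracketTwo, bracketThree, qJet_zero]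
  ring

theorem differentiableOn_bracketTwo (h : DifferentiableOn ℂ f U) (hU : IsOpen U) :
    DifferentiableOn ℂ (fun t => bracketTwo 1 (qJet f t)) U := fun _ hτ =>
  (hasQDerivAt_bracketTwo h hU hτ).differentiableAt.differentiableWithinAt

theorem differentiableOn_bracketThree (h : DifferentiableOn ℂ f U) (hU : IsOpen U) :
    DifferentiableOn ℂ (fun t => bracketThree 1 (qJet f t)) U := by
  have d := differentiableOn_qJet h hU
  have := d 0
  have := d 1
  have := d 2
  have := d 3
  unfold bracketThree
  fun_prop

theorem differentiableOn_ode4 (h : DifferentiableOn ℂ f U) (hU : IsOpen U) :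
    DifferentiableOn ℂ (fun t => ode4 (qJet f t)) U := by
  have d := differentiableOn_qJet h hU
  have := d 0
  have := d 1
  have := d 2
  have := d 3
  have := d 4
  unfold ode4
  fun_prop

theorem mul_qDeriv_ode3 (h : DifferentiableOn ℂ f U) (hU : IsOpen U) (hτ : τ ∈ U) :
    f τ * bracketTwo 1 (qJet f τ) * qDeriv (fun t => ode3 (qJet f t)) τ =
      2 * bracketThree 1 (qJet f τ) * ode4 (qJet f τ)
        + (2 * bracketThree 1 (qJet f τ) + 16 * qJet f τ 1 * bracketTwo 1 (qJet f τ))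
          * ode3 (qJet f τ) := by
  have d := hasQDerivAt_qJet h hU hτ
  have hd : HasQDerivAt (fun t => ode3 (qJet f t)) _ τ :=
    (((((((d 0).pow 2).mul ((d 3).pow 2)).sub
      ((((d 1).const_mul 6).mul ((((d 0).const_mul 3).mul (d 2)).sub
        (((d 1).pow 2).const_mul 4))).mul (d 3))).add
      (((d 0).const_mul 18).mul ((d 2).pow 3))).sub
      ((((d 0).pow 6).add (((d 1).pow 2).const_mul 27)).mul ((d 2).pow 2))).add
      (((((d 0).pow 5).const_mul 4).mul ((d 1).pow 2)).mul (d 2))).sub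
      ((((d 0).pow 4).const_mul 4).mul ((d 1).pow 4))
  rw [hd.qDeriv_eq]
  simp only [bracketTwo, bracketThree, ode3, ode4, qJet_zero]
  push_cast
  ring

theorem IsSolutionOn.bracketThree_mul_ode4_eq_zero (h : IsSolutionOn ode3 f U) (hU : IsOpen U)
    (hτ : τ ∈ U) : bracketThree 1 (qJet f τ) * ode4 (qJet f τ) = 0 := by
  have hd : qDeriv (fun t => ode3 (qJet f t)) τ = 0 :=
    ((HasQDerivAt.const 0 τ).congr_of_eqOn hU hτ h.2).qDeriv_eq
  have := mul_qDeriv_ode3 h.1 hU hτ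
  rw [hd, h.2 τ hτ] at this
  linear_combination -this / 2

/-- If `bracketThree 1` vanishes identically, so does `B² (18 B - f⁶)` with `B = bracketTwo 1`;
the second factor is the singular solution. -/
theorem IsSolutionOn.bracketTwo_eq_zero (hU : IsOpen U) (hc : IsPreconnected U)
    (h : IsSolutionOn ode3 f U) (hns : ∃ τ ∈ U, f τ ≠ 0 ∧ invI 1 (qJet f τ) ≠ 1 / 18)
    (hC : ∀ τ ∈ U, bracketThree 1 (qJet f τ) = 0) : ∀ τ ∈ U, bracketTwo 1 (qJet f τ) = 0 := by
  have hB := differentiableOn_bracketTwo h.1 hU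
  have hprod : ∀ τ ∈ U, bracketTwo 1 (qJet f τ) ^ 2
      * (18 * bracketTwo 1 (qJet f τ) - f τ ^ 6) = 0 := fun τ hτ => by
    have := sq_mul_ode3 (qJet f τ)
    rw [h.2 τ hτ, hC τ hτ, qJet_zero] at this
    linear_combination -this
  refine (eqOn_zero_or_eqOn_zero_of_mul hU hc (hB.fun_pow 2)
    ((hB.const_mul 18).fun_sub (h.1.fun_pow 6)) hprod).elim
    (fun h2 τ hτ => pow_eq_zero_iff two_ne_zero |>.1 (h2 τ hτ)) fun hsing => ?_
  obtain ⟨τ₀, hτ₀, hf₀, hI⟩ := hns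
  refine absurd ?_ hI
  rw [invI_one, qJet_zero, div_eq_div_iff (pow_ne_zero _ hf₀) (by norm_num)]
  linear_combination hsing τ₀ hτ₀

theorem IsSolutionOn.ode4_of_ode3 (hU : IsOpen U) (hc : IsPreconnected U)
    (h : IsSolutionOn ode3 f U)
    (hns : ∃ τ ∈ U, f τ ≠ 0 ∧ invI 1 (qJet f τ) ≠ 1 / 18) : IsSolutionOn ode4 f U := by
  refine ⟨h.1, ?_⟩
  rcases eqOn_zero_or_eqOn_zero_of_mul hU hc (differentiableOn_bracketThree h.1 hU)
    (differentiableOn_ode4 h.1 hU) fun τ hτ => h.bracketThree_mul_ode4_eq_zero hU hτ with hC | h4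
  · exact fun τ hτ => ode4_eq_zero_of_brackets_eq_zero (h.bracketTwo_eq_zero hU hc hns hC τ hτ)
      (hC τ hτ)
  · exact h4

end DifferentialConsequence

section HuberSystem

variable {f M N : ℂ → ℂ} {U : Set ℂ}

theorem IsHuberSolutionOn.hasQDerivAt (hU : IsOpen U) (h : IsHuberSolutionOn f M N U) {τ : ℂ}
    (hτ : τ ∈ U) :
    HasQDerivAt f ((M τ * f τ - N τ) / 3) τ ∧ HasQDerivAt M ((M τ ^ 2 - N τ * f τ) / 3) τ ∧
      HasQDerivAt N ((M τ - f τ ^ 2) * N τ) τ := by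
  obtain ⟨hf, hM, hN, heq⟩ := h
  obtain ⟨ef, eM, eN⟩ := heq τ hτ
  have hnhds := hU.mem_nhds hτ
  exact ⟨ef ▸ .of_differentiableAt (hf.differentiableAt hnhds),
    eM ▸ .of_differentiableAt (hM.differentiableAt hnhds),
    eN ▸ .of_differentiableAt (hN.differentiableAt hnhds)⟩

theorem IsHuberSolutionOn.qJet_one_eqOn (h : IsHuberSolutionOn f M N U) :
    EqOn (fun t => qJet f t 1) (fun t => (M t * f t - N t) / 3) U :=
  fun τ hτ => (h.2.2.2 τ hτ).1

theorem IsHuberSolutionOn.qJet_two_eqOn (hU : IsOpen U) (h : IsHuberSolutionOn f M N U) :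
    EqOn (fun t => qJet f t 2)
      (fun t => (2 * M t ^ 2 * f t - 4 * M t * N t + 2 * N t * f t ^ 2) / 9) U :=
  qJet_succ_eqOn hU h.qJet_one_eqOn fun τ hτ => by
    obtain ⟨df, dM, dN⟩ := h.hasQDerivAt hU hτ
    exact (((dM.mul df).sub dN).div_const 3).congr_deriv (by ring)

theorem IsHuberSolutionOn.qJet_three_eqOn (hU : IsOpen U) (h : IsHuberSolutionOn f M N U) :
    EqOn (fun t => qJet f t 3)
      (fun t => (6 * M t ^ 3 * f t + 18 * M t * N t * f t ^ 2 - 6 * f t ^ 4 * N t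
        - 18 * M t ^ 2 * N t) / 27) U :=
  qJet_succ_eqOn hU (h.qJet_two_eqOn hU) fun τ hτ => by
    obtain ⟨df, dM, dN⟩ := h.hasQDerivAt hU hτ
    exact ((((((dM.pow 2).const_mul 2).mul df).sub ((dM.const_mul 4).mul dN)).add
      ((dN.const_mul 2).mul (df.pow 2))).div_const 9).congr_deriv (by push_cast; ring)

theorem IsHuberSolutionOn.isSolutionOn_ode3 (hU : IsOpen U) (h : IsHuberSolutionOn f M N U) :
    IsSolutionOn ode3 f U := by
  refine ⟨h.1, fun τ hτ => ?_⟩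
  have h1 := h.qJet_one_eqOn hτ
  have h2 := h.qJet_two_eqOn hU hτ
  have h3 := h.qJet_three_eqOn hU hτ
  simp only at h1 h2 h3
  simp only [ode3, h1, h2, h3, qJet_zero]
  ring

end HuberSystem

section HuberConverse

/-- The component `N` of Huber's system recovered from a solution `f` of the third-order
equation: with `B = bracketTwo 1` and `C = bracketThree 1`, the system forces
`N - (f³ - N) = C / B`. -/
noncomputable def huberN (f : ℂ → ℂ) (τ : ℂ) : ℂ :=
  (f τ ^ 3 + bracketThree 1 (qJet f τ) / bracketTwo 1 (qJet f τ)) / 2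

/-- The complementary quantity `L = f³ - N`, which satisfies `L' = M L` in Huber's system. -/
noncomputable def huberL (f : ℂ → ℂ) (τ : ℂ) : ℂ :=
  (f τ ^ 3 - bracketThree 1 (qJet f τ) / bracketTwo 1 (qJet f τ)) / 2

/-- The component `M` of Huber's system recovered from a solution `f` of the third-order
equation, as the logarithmic derivative of `huberL f`. -/
noncomputable def huberM (f : ℂ → ℂ) (τ : ℂ) : ℂ :=
  qDeriv (huberL f) τ / huberL f τ

theorem huberN_add_huberL (f : ℂ → ℂ) (τ : ℂ) : huberN f τ + huberL f τ = f τ ^ 3 := by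
  rw [huberN, huberL]
  ring

theorem huberN_sub_huberL (f : ℂ → ℂ) (τ : ℂ) :
    huberN f τ - huberL f τ = bracketThree 1 (qJet f τ) / bracketTwo 1 (qJet f τ) := by
  rw [huberN, huberL]
  ring

variable {f : ℂ → ℂ} {U : Set ℂ} {τ : ℂ}

theorem huberN_mul_huberL (h : ode3 (qJet f τ) = 0) (hB : bracketTwo 1 (qJet f τ) ≠ 0) :
    huberN f τ * huberL f τ = 9 / 2 * bracketTwo 1 (qJet f τ) := by
  have hrel := sq_mul_ode3 (qJet f τ)
  rw [h, qJet_zero] at hrel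
  rw [huberN, huberL]
  field_simp
  linear_combination hrel

theorem huberN_mul_huberL_ne_zero (h : ode3 (qJet f τ) = 0)
    (hB : bracketTwo 1 (qJet f τ) ≠ 0) : huberN f τ * huberL f τ ≠ 0 := by
  rw [huberN_mul_huberL h hB]
  exact mul_ne_zero (by norm_num) hB

theorem differentiableOn_bracketThree_div_bracketTwo (hU : IsOpen U) (hf : DifferentiableOn ℂ f U)
    (hB : ∀ τ ∈ U, bracketTwo 1 (qJet f τ) ≠ 0) :
    DifferentiableOn ℂ (fun t => bracketThree 1 (qJet f t) / bracketTwo 1 (qJet f t)) U :=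
  (differentiableOn_bracketThree hf hU).fun_div (differentiableOn_bracketTwo hf hU) hB

theorem differentiableOn_huberN (hU : IsOpen U) (hf : DifferentiableOn ℂ f U)
    (hB : ∀ τ ∈ U, bracketTwo 1 (qJet f τ) ≠ 0) : DifferentiableOn ℂ (huberN f) U :=
  ((hf.fun_pow 3).fun_add
    (differentiableOn_bracketThree_div_bracketTwo hU hf hB)).div_const 2

theorem differentiableOn_huberL (hU : IsOpen U) (hf : DifferentiableOn ℂ f U)
    (hB : ∀ τ ∈ U, bracketTwo 1 (qJet f τ) ≠ 0) : DifferentiableOn ℂ (huberL f) U :=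
  ((hf.fun_pow 3).fun_sub
    (differentiableOn_bracketThree_div_bracketTwo hU hf hB)).div_const 2

theorem differentiableOn_huberM (hU : IsOpen U) (h : IsSolutionOn ode3 f U)
    (hB : ∀ τ ∈ U, bracketTwo 1 (qJet f τ) ≠ 0) : DifferentiableOn ℂ (huberM f) U :=
  have hL := differentiableOn_huberL hU h.1 hB
  (differentiableOn_qDeriv hL hU).fun_div hL fun τ hτ =>
    right_ne_zero_of_mul (huberN_mul_huberL_ne_zero (h.2 τ hτ) (hB τ hτ))

theorem hasQDerivAt_huberN (hU : IsOpen U) (hf : DifferentiableOn ℂ f U)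
    (hB : ∀ τ ∈ U, bracketTwo 1 (qJet f τ) ≠ 0) (hτ : τ ∈ U) :
    HasQDerivAt (huberN f) (qDeriv (huberN f) τ) τ :=
  .of_differentiableAt ((differentiableOn_huberN hU hf hB).differentiableAt (hU.mem_nhds hτ))

theorem hasQDerivAt_huberL (hU : IsOpen U) (hf : DifferentiableOn ℂ f U)
    (hB : ∀ τ ∈ U, bracketTwo 1 (qJet f τ) ≠ 0) (hτ : τ ∈ U) :
    HasQDerivAt (huberL f) (qDeriv (huberL f) τ) τ :=
  .of_differentiableAt ((differentiableOn_huberL hU hf hB).differentiableAt (hU.mem_nhds hτ))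

theorem qDeriv_huberN_add_qDeriv_huberL (hU : IsOpen U) (hf : DifferentiableOn ℂ f U)
    (hB : ∀ τ ∈ U, bracketTwo 1 (qJet f τ) ≠ 0) (hτ : τ ∈ U) :
    qDeriv (huberN f) τ + qDeriv (huberL f) τ = 3 * f τ ^ 2 * qJet f τ 1 := by
  have hsum := (hasQDerivAt_huberN hU hf hB hτ).add (hasQDerivAt_huberL hU hf hB hτ)
  have hcube := (hasQDerivAt_qJet hf hU hτ 0).pow 3
  exact (hsum.congr_of_eqOn hU hτ fun t _ => (huberN_add_huberL f t).symm).unique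
    (hcube.congr_deriv (by simp [qJet_zero]))

theorem mul_qDeriv_huberN_mul_huberL (hU : IsOpen U) (h : IsSolutionOn ode3 f U)
    (hB : ∀ τ ∈ U, bracketTwo 1 (qJet f τ) ≠ 0) (hτ : τ ∈ U) :
    f τ * (qDeriv (huberN f) τ * huberL f τ + huberN f τ * qDeriv (huberL f) τ) =
      (6 * qJet f τ 1 + huberN f τ - huberL f τ) * (huberN f τ * huberL f τ) := by
  have hprod := (hasQDerivAt_huberN hU h.1 hB hτ).mul (hasQDerivAt_huberL hU h.1 hB hτ)
  have hB' := hasQDerivAt_bracketTwo h.1 hU hτ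
  rw [(hprod.congr_of_eqOn hU hτ
      fun t ht => (huberN_mul_huberL (h.2 t ht) (hB t ht)).symm).unique (hB'.const_mul (9 / 2)),
    add_sub_assoc, huberN_mul_huberL (h.2 τ hτ) (hB τ hτ), huberN_sub_huberL, ← hB'.qDeriv_eq]
  have := hB τ hτ
  field_simp
  linear_combination mul_qDeriv_bracketTwo h.1 hU hτ

/-- `N L' - L N' = f² N L` holds after multiplication by `N - L = C / B`, and
`C = bracketThree 1` is not identically zero. -/
theorem huber_wronskian (hU : IsOpen U) (hc : IsPreconnected U) (h : IsSolutionOn ode3 f U)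
    (hB : ∀ τ ∈ U, bracketTwo 1 (qJet f τ) ≠ 0)
    (hC : ∃ τ ∈ U, bracketThree 1 (qJet f τ) ≠ 0) (hτ : τ ∈ U) :
    huberN f τ * qDeriv (huberL f) τ - huberL f τ * qDeriv (huberN f) τ
      - f τ ^ 2 * (huberN f τ * huberL f τ) = 0 := by
  have dN := differentiableOn_huberN hU h.1 hB
  have dL := differentiableOn_huberL hU h.1 hB
  have dN' := differentiableOn_qDeriv dN hU
  have dL' := differentiableOn_qDeriv dL hU
  have df := h.1
  refine (eqOn_zero_or_eqOn_zero_of_mul hU hc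
    (differentiableOn_bracketThree_div_bracketTwo hU h.1 hB)
    (g := fun τ => huberN f τ * qDeriv (huberL f) τ - huberL f τ * qDeriv (huberN f) τ
      - f τ ^ 2 * (huberN f τ * huberL f τ)) (by fun_prop) fun τ hτ => ?_).resolve_left
    (fun hzero => ?_) τ hτ
  · rw [← huberN_sub_huberL]
    linear_combination f τ ^ 2 * mul_qDeriv_huberN_mul_huberL hU h hB hτ
      - 2 * huberN f τ * huberL f τ * qDeriv_huberN_add_qDeriv_huberL hU h.1 hB hτ
      + (qDeriv (huberN f) τ * huberL f τ + huberN f τ * qDeriv (huberL f) τ)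
        * huberN_add_huberL f τ
  · obtain ⟨τ₀, hτ₀, hC₀⟩ := hC
    exact div_ne_zero hC₀ (hB τ₀ hτ₀) (hzero τ₀ hτ₀)

theorem qDeriv_huberL (h : ode3 (qJet f τ) = 0) (hB : bracketTwo 1 (qJet f τ) ≠ 0) :
    qDeriv (huberL f) τ = huberM f τ * huberL f τ :=
  (div_mul_cancel₀ _ (right_ne_zero_of_mul (huberN_mul_huberL_ne_zero h hB))).symm

theorem qDeriv_huberN (hU : IsOpen U) (hc : IsPreconnected U) (h : IsSolutionOn ode3 f U)
    (hB : ∀ τ ∈ U, bracketTwo 1 (qJet f τ) ≠ 0)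
    (hC : ∃ τ ∈ U, bracketThree 1 (qJet f τ) ≠ 0) (hτ : τ ∈ U) :
    qDeriv (huberN f) τ = (huberM f τ - f τ ^ 2) * huberN f τ := by
  refine mul_left_cancel₀
    (right_ne_zero_of_mul (huberN_mul_huberL_ne_zero (h.2 τ hτ) (hB τ hτ))) ?_
  linear_combination -huber_wronskian hU hc h hB hC hτ
    + huberN f τ * qDeriv_huberL (h.2 τ hτ) (hB τ hτ)

theorem mul_huberM (hU : IsOpen U) (hc : IsPreconnected U) (h : IsSolutionOn ode3 f U)
    (hB : ∀ τ ∈ U, bracketTwo 1 (qJet f τ) ≠ 0)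
    (hC : ∃ τ ∈ U, bracketThree 1 (qJet f τ) ≠ 0) (hτ : τ ∈ U) :
    f τ * huberM f τ = 3 * qJet f τ 1 + huberN f τ := by
  have hprod := mul_qDeriv_huberN_mul_huberL hU h hB hτ
  rw [qDeriv_huberL (h.2 τ hτ) (hB τ hτ), qDeriv_huberN hU hc h hB hC hτ] at hprod
  refine mul_left_cancel₀ (huberN_mul_huberL_ne_zero (h.2 τ hτ) (hB τ hτ)) ?_
  linear_combination (1 / 2) * hprod
    - huberN f τ * huberL f τ / 2 * huberN_add_huberL f τ

theorem sq_mul_qDeriv_huberM (hU : IsOpen U) (hc : IsPreconnected U) (h : IsSolutionOn ode3 f U)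
    (hB : ∀ τ ∈ U, bracketTwo 1 (qJet f τ) ≠ 0)
    (hC : ∃ τ ∈ U, bracketThree 1 (qJet f τ) ≠ 0) (hτ : τ ∈ U) :
    f τ ^ 2 * (qDeriv (huberM f) τ - (huberM f τ ^ 2 - huberN f τ * f τ) / 3) = 0 := by
  have hM : HasQDerivAt (huberM f) (qDeriv (huberM f) τ) τ :=
    .of_differentiableAt ((differentiableOn_huberM hU h hB).differentiableAt (hU.mem_nhds hτ))
  have hderiv := (((hasQDerivAt_qJet h.1 hU hτ 0).mul hM).congr_of_eqOn hU hτ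
    fun t ht => (mul_huberM hU hc h hB hC ht).symm).unique
      (((hasQDerivAt_qJet h.1 hU hτ 1).const_mul 3).add (hasQDerivAt_huberN hU h.1 hB hτ))
  have hNL := huberN_mul_huberL (h.2 τ hτ) (hB τ hτ)
  have hL : huberL f τ = f τ ^ 3 - huberN f τ := by
    linear_combination huberN_add_huberL f τ
  have hf' : qJet f τ 1 = (f τ * huberM f τ - huberN f τ) / 3 := by
    linear_combination -mul_huberM hU hc h hB hC hτ / 3
  rw [bracketTwo, hL, hf', qJet_zero] at hNL
  rw [qDeriv_huberN hU hc h hB hC hτ, hf', qJet_zero] at hderiv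
  linear_combination f τ * hderiv - (2 / 3) * hNL

theorem qDeriv_huberM (hU : IsOpen U) (hc : IsPreconnected U) (h : IsSolutionOn ode3 f U)
    (hB : ∀ τ ∈ U, bracketTwo 1 (qJet f τ) ≠ 0)
    (hC : ∃ τ ∈ U, bracketThree 1 (qJet f τ) ≠ 0) (hτ : τ ∈ U) :
    qDeriv (huberM f) τ = (huberM f τ ^ 2 - huberN f τ * f τ) / 3 := by
  have df := h.1
  have dN := differentiableOn_huberN hU h.1 hB
  have dM := differentiableOn_huberM hU h hB
  have dM' := differentiableOn_qDeriv dM hU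
  refine sub_eq_zero.1 ((eqOn_zero_or_eqOn_zero_of_mul hU hc (h.1.fun_pow 2)
    (g := fun τ => qDeriv (huberM f) τ - (huberM f τ ^ 2 - huberN f τ * f τ) / 3)
    (by fun_prop) fun τ hτ => sq_mul_qDeriv_huberM hU hc h hB hC hτ).resolve_left
    (fun hzero => ?_) τ hτ)
  have hf : ∀ τ ∈ U, f τ = 0 := fun τ hτ => pow_eq_zero_iff two_ne_zero |>.1 (hzero τ hτ)
  have hf' : qJet f τ 1 = 0 := ((HasQDerivAt.const 0 τ).congr_of_eqOn hU hτ hf).qDeriv_eq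
  exact hB τ hτ (by simp [bracketTwo, qJet_zero, hf τ hτ, hf'])

theorem IsSolutionOn.isHuberSolutionOn (hU : IsOpen U) (hc : IsPreconnected U)
    (h : IsSolutionOn ode3 f U) (hB : ∀ τ ∈ U, bracketTwo 1 (qJet f τ) ≠ 0)
    (hC : ∃ τ ∈ U, bracketThree 1 (qJet f τ) ≠ 0) :
    IsHuberSolutionOn f (huberM f) (huberN f) U := by
  refine ⟨h.1, differentiableOn_huberM hU h hB, differentiableOn_huberN hU h.1 hB, fun τ hτ =>
    ⟨?_, qDeriv_huberM hU hc h hB hC hτ, qDeriv_huberN hU hc h hB hC hτ⟩⟩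
  rw [← qJet_one]
  linear_combination -mul_huberM hU hc h hB hC hτ / 3

end HuberConverse

section Moebius

variable {A : Matrix (Fin 2) (Fin 2) ℝ} {U : Set ℂ} {τ : ℂ}

theorem autFactor_inv_moebius (hA : A.det ≠ 0) (hτ : autFactor A τ ≠ 0) :
    autFactor A⁻¹ (moebius A τ) = (autFactor A τ)⁻¹ := by
  have hd : (A 0 0 * A 1 1 - A 0 1 * A 1 0 : ℂ) ≠ 0 := by
    rw [Matrix.det_fin_two] at hA; exact_mod_cast hA
  refine eq_inv_of_mul_eq_one_left ?_
  rw [moebius, Matrix.inv_def, Matrix.adjugate_fin_two]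
  simp only [autFactor, Matrix.det_fin_two, Ring.inverse_eq_inv'] at hτ ⊢
  simp only [Fin.isValue, Matrix.smul_apply, Matrix.of_apply, Matrix.cons_val',
    Matrix.cons_val_zero, Matrix.cons_val_fin_one, Matrix.cons_val_one, smul_eq_mul,
    Complex.ofReal_neg, Complex.ofReal_mul, Complex.ofReal_inv, Complex.ofReal_sub]
  field_simp
  ring

theorem moebius_inv_moebius (hA : A.det ≠ 0) (hτ : autFactor A τ ≠ 0) :
    moebius A⁻¹ (moebius A τ) = τ := by
  have hd : (A 0 0 * A 1 1 - A 0 1 * A 1 0 : ℂ) ≠ 0 := by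
    rw [Matrix.det_fin_two] at hA; exact_mod_cast hA
  rw [moebius, autFactor_inv_moebius hA hτ, div_inv_eq_mul, moebius, Matrix.inv_def,
    Matrix.adjugate_fin_two]
  simp only [autFactor, Matrix.det_fin_two, Ring.inverse_eq_inv'] at hτ ⊢
  simp only [Fin.isValue, Matrix.smul_apply, Matrix.of_apply, Matrix.cons_val',
    Matrix.cons_val_zero, Matrix.cons_val_fin_one, Matrix.cons_val_one, smul_eq_mul,
    Complex.ofReal_neg, Complex.ofReal_mul, Complex.ofReal_inv, Complex.ofReal_sub]
  field_simp
  ring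

theorem differentiable_autFactor (A : Matrix (Fin 2) (Fin 2) ℝ) :
    Differentiable ℂ (autFactor A) := by
  unfold autFactor
  fun_prop

theorem hasDerivAt_autFactor (A : Matrix (Fin 2) (Fin 2) ℝ) (τ : ℂ) :
    HasDerivAt (autFactor A) (A 1 0) τ :=
  (((hasDerivAt_id τ).const_mul (A 1 0 : ℂ)).add_const (A 1 1 : ℂ)).congr_deriv (mul_one _)

theorem hasQDerivAt_autFactor (A : Matrix (Fin 2) (Fin 2) ℝ) (τ : ℂ) :
    HasQDerivAt (autFactor A) (A 1 0 / (2 * Real.pi * Complex.I)) τ :=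
  (hasDerivAt_autFactor A τ).congr_deriv (mul_div_cancel₀ _ Complex.two_pi_I_ne_zero).symm

theorem hasDerivAt_moebius (hτ : autFactor A τ ≠ 0) :
    HasDerivAt (moebius A) (A.det / autFactor A τ ^ 2) τ := by
  have hnum : HasDerivAt (fun t : ℂ => (A 0 0 : ℂ) * t + (A 0 1 : ℂ)) (A 0 0) τ :=
    (((hasDerivAt_id τ).const_mul (A 0 0 : ℂ)).add_const (A 0 1 : ℂ)).congr_deriv (mul_one _)
  refine (hnum.div (hasDerivAt_autFactor A τ) hτ).congr_deriv ?_
  rw [Matrix.det_fin_two, autFactor]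
  push_cast
  ring

theorem autFactor_inv_ne_zero (hA : A.det ≠ 0) (hU : ∀ τ ∈ U, autFactor A τ ≠ 0) {w : ℂ}
    (hw : w ∈ moebius A '' U) : autFactor A⁻¹ w ≠ 0 := by
  obtain ⟨τ, hτ, rfl⟩ := hw
  rw [autFactor_inv_moebius hA (hU τ hτ)]
  exact inv_ne_zero (hU τ hτ)

theorem isOpen_image_moebius (hA : A.det ≠ 0) (hUo : IsOpen U)
    (hU : ∀ τ ∈ U, autFactor A τ ≠ 0) : IsOpen (moebius A '' U) := by
  have hV : IsOpen {w | autFactor A⁻¹ w ≠ 0} :=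
    isOpen_ne_fun (differentiable_autFactor _).continuous continuous_const
  have hcont : ContinuousOn (moebius A⁻¹) {w | autFactor A⁻¹ w ≠ 0} := fun w hw =>
    (hasDerivAt_moebius hw).continuousAt.continuousWithinAt
  convert hcont.isOpen_inter_preimage hV hUo using 1
  ext w
  constructor
  · rintro ⟨τ, hτ, rfl⟩
    refine ⟨autFactor_inv_ne_zero hA hU ⟨τ, hτ, rfl⟩, ?_⟩
    rwa [mem_preimage, moebius_inv_moebius hA (hU τ hτ)]
  · rintro ⟨hw, hwU⟩
    have hAinv : A⁻¹.det ≠ 0 := by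
      rw [Matrix.det_nonsing_inv, Ring.inverse_eq_inv']
      exact inv_ne_zero hA
    have := moebius_inv_moebius hAinv hw
    rw [Matrix.nonsing_inv_nonsing_inv _ (isUnit_iff_ne_zero.2 hA)] at this
    exact ⟨_, hwU, this⟩

variable {k : ℤ} {f g : ℂ → ℂ}

theorem differentiableOn_image_moebius (hA : A.det ≠ 0) (hU : ∀ τ ∈ U, autFactor A τ ≠ 0)
    (hg : ∀ τ ∈ U, g (moebius A τ) = autFactor A τ ^ k * f τ) (hf : DifferentiableOn ℂ f U) :
    DifferentiableOn ℂ g (moebius A '' U) := by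
  have hmaps : MapsTo (moebius A⁻¹) (moebius A '' U) U := by
    rintro _ ⟨τ, hτ, rfl⟩
    rwa [moebius_inv_moebius hA (hU τ hτ)]
  have hinv : DifferentiableOn ℂ (moebius A⁻¹) (moebius A '' U) := fun w hw =>
    (hasDerivAt_moebius (autFactor_inv_ne_zero hA hU hw)).differentiableAt.differentiableWithinAt
  have hpow : DifferentiableOn ℂ (fun τ => autFactor A τ ^ k) U := fun τ hτ =>
    ((differentiable_autFactor A τ).zpow (.inl (hU τ hτ))).differentiableWithinAt
  refine ((hpow.fun_mul hf).comp hinv hmaps).congr ?_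
  rintro _ ⟨τ, hτ, rfl⟩
  rw [Function.comp_apply, moebius_inv_moebius hA (hU τ hτ), hg τ hτ]

theorem differentiableOn_of_image_moebius (hU : ∀ τ ∈ U, autFactor A τ ≠ 0)
    (hg : ∀ τ ∈ U, g (moebius A τ) = autFactor A τ ^ k * f τ)
    (hgd : DifferentiableOn ℂ g (moebius A '' U)) : DifferentiableOn ℂ f U := by
  have hmoebius : DifferentiableOn ℂ (moebius A) U := fun τ hτ =>
    (hasDerivAt_moebius (hU τ hτ)).differentiableAt.differentiableWithinAt
  have hpow : DifferentiableOn ℂ (fun τ => autFactor A τ ^ k) U := fun τ hτ =>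
    ((differentiable_autFactor A τ).zpow (.inl (hU τ hτ))).differentiableWithinAt
  refine ((hgd.comp hmoebius (mapsTo_image _ _)).fun_div hpow
    fun τ hτ => zpow_ne_zero k (hU τ hτ)).congr fun τ hτ => ?_
  rw [Function.comp_apply, hg τ hτ, mul_div_cancel_left₀ _ (zpow_ne_zero k (hU τ hτ))]

theorem qJet_succ_moebius {Φ : ℂ → ℂ} {φ : ℂ} {n : ℕ} (hA : A.det ≠ 0) (hUo : IsOpen U)
    (hU : ∀ τ ∈ U, autFactor A τ ≠ 0) (hg : DifferentiableOn ℂ g (moebius A '' U))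
    (h : ∀ τ ∈ U, qJet g (moebius A τ) n = Φ τ) (hτ : τ ∈ U) (hΦ : HasQDerivAt Φ φ τ) :
    qJet g (moebius A τ) (n + 1) = autFactor A τ ^ 2 / A.det * φ := by
  have hjet := hasQDerivAt_qJet hg (isOpen_image_moebius hA hUo hU) (mem_image_of_mem _ hτ) n
  have hcomp : HasDerivAt ((fun t => qJet g t n) ∘ moebius A) _ τ :=
    HasDerivAt.comp τ hjet (hasDerivAt_moebius (hU τ hτ))
  have hchain := hcomp.unique (hΦ.congr_of_eqOn hUo hτ h)
  have hd : (A.det : ℂ) ≠ 0 := by exact_mod_cast hA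
  have hJ := hU τ hτ
  rw [mul_assoc] at hchain
  rw [← mul_left_cancel₀ Complex.two_pi_I_ne_zero hchain]
  field_simp

/-- The coefficients of the action of weight `k` on jets: `n.choose j` times the falling factorial
`(k + n - 1) (k + n - 2) ⋯ (k + n - j)`. -/
def jetCoeff (k : ℂ) (n j : ℕ) : ℂ :=
  n.choose j * ∏ i ∈ Finset.range j, (k + n - 1 - i)

/-- The jet of `(cτ + d)^k f` with respect to `(aτ + b) / (cτ + d)` in terms of the jet `y` of `f`,
where `J = cτ + d`, `κ = c / (2πi)` is the `q`-derivative of `J`, and `δ = ad - bc`. -/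
noncomputable def jetTransform (k : ℤ) (J κ δ : ℂ) (y : ℕ → ℂ) (n : ℕ) : ℂ :=
  J ^ k / δ ^ n * ∑ j ∈ Finset.range (n + 1), jetCoeff k n j * κ ^ j * J ^ (2 * n - j) * y (n - j)

theorem jetCoeff_zero_right (k : ℂ) (n : ℕ) : jetCoeff k n 0 = 1 := by
  simp [jetCoeff]

theorem jetCoeff_succ_self (k : ℂ) (n : ℕ) : jetCoeff k n (n + 1) = 0 := by
  simp [jetCoeff]

theorem jetCoeff_succ_succ (k : ℂ) (n j : ℕ) :
    jetCoeff k (n + 1) (j + 1) = jetCoeff k n (j + 1) + (k + 2 * n - j) * jetCoeff k n j := by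
  have hprod : ∏ i ∈ Finset.range (j + 1), (k + (n + 1 : ℕ) - 1 - i) =
      (k + n) * ∏ i ∈ Finset.range j, (k + n - 1 - i) := by
    rw [Finset.prod_range_succ', mul_comm]
    congr 1
    · push_cast
      ring
    · refine Finset.prod_congr rfl fun i _ => ?_
      push_cast
      ring
  have hchoose : (n.choose (j + 1) : ℂ) * (j + 1) = n.choose j * (n - j) := by
    rcases le_or_gt j n with hj | hj
    · rw [← Nat.cast_sub hj]
      exact_mod_cast Nat.choose_succ_right_eq n j
    · simp [Nat.choose_eq_zero_of_lt hj, Nat.choose_eq_zero_of_lt (hj.trans (Nat.lt_succ_self j))]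
  rw [jetCoeff, jetCoeff, jetCoeff, hprod, Finset.prod_range_succ, Nat.choose_succ_succ]
  push_cast
  linear_combination (∏ i ∈ Finset.range j, (k + n - 1 - i)) * hchoose

theorem jetCoeff_sum_succ (k : ℂ) (n : ℕ) (t : ℕ → ℂ) :
    ∑ j ∈ Finset.range (n + 2), jetCoeff k (n + 1) j * t j =
      ∑ j ∈ Finset.range (n + 1), jetCoeff k n j * (t j + (k + 2 * n - j) * t (j + 1)) := by
  have hshift : ∑ j ∈ Finset.range (n + 1), jetCoeff k n (j + 1) * t (j + 1) + t 0 =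
      ∑ j ∈ Finset.range (n + 1), jetCoeff k n j * t j := by
    have := Finset.sum_range_succ' (fun j => jetCoeff k n j * t j) (n + 1)
    rw [Finset.sum_range_succ, jetCoeff_succ_self, jetCoeff_zero_right] at this
    linear_combination -this
  rw [Finset.sum_range_succ', jetCoeff_zero_right]
  simp only [jetCoeff_succ_succ, add_mul, mul_add, Finset.sum_add_distrib]
  simp only [← hshift, mul_assoc, mul_left_comm]
  ring

theorem hasQDerivAt_zpow_mul_pow_mul {J κ : ℂ} {ψ : ℂ → ℂ} {φ : ℂ → ℂ} {a : ℂ} (k : ℤ) (m : ℕ)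
    (hφ : HasQDerivAt φ κ τ) (hJ : φ τ = J) (hJ0 : J ≠ 0) (hψ : HasQDerivAt ψ a τ) :
    HasQDerivAt (fun t => φ t ^ k * (φ t ^ m * ψ t))
      (J ^ k * J ^ m * (a + (k + m) * κ / J * ψ τ)) τ := by
  subst hJ
  refine ((hφ.zpow k hJ0).mul ((hφ.pow m).mul hψ)).congr_deriv ?_
  rw [zpow_sub_one₀ hJ0]
  cases m with
  | zero =>
    field_simp
    simp only [CharP.cast_eq_zero, mul_zero, zero_tsub, pow_zero, mul_one, zero_add, add_zero]
    ring
  | succ m =>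
    rw [Nat.add_sub_cancel]
    field_simp
    push_cast
    ring

theorem hasQDerivAt_jetTransform (hτ : autFactor A τ ≠ 0) {δ : ℂ} (hδ : δ ≠ 0)
    (hf : ∀ n, HasQDerivAt (fun t => qJet f t n) (qJet f τ (n + 1)) τ) (n : ℕ) :
    HasQDerivAt
      (fun t => jetTransform k (autFactor A t) (A 1 0 / (2 * Real.pi * Complex.I)) δ (qJet f t) n)
      (δ / autFactor A τ ^ 2 *
        jetTransform k (autFactor A τ) (A 1 0 / (2 * Real.pi * Complex.I)) δ (qJet f τ) (n + 1))
      τ := by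
  have hκ := hasQDerivAt_autFactor A τ
  set κ : ℂ := A 1 0 / (2 * Real.pi * Complex.I)
  set J : ℂ := autFactor A τ with hJ
  have hterm : ∀ j ∈ Finset.range (n + 1), HasQDerivAt
      (fun t => jetCoeff k n j * κ ^ j / δ ^ n *
        (autFactor A t ^ k * (autFactor A t ^ (2 * n - j) * qJet f t (n - j))))
      (jetCoeff k n j * κ ^ j / δ ^ n * (J ^ k * J ^ (2 * n - j) * (qJet f τ (n + 1 - j)
        + (k + 2 * n - j) * κ / J * qJet f τ (n - j)))) τ := fun j hj => by
    have hjn : j ≤ n := Nat.lt_succ_iff.1 (Finset.mem_range.1 hj)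
    refine ((hasQDerivAt_zpow_mul_pow_mul k (2 * n - j) hκ hJ.symm hτ (hf (n - j))).const_mul
      _).congr_deriv ?_
    rw [Nat.sub_add_comm hjn, Nat.cast_sub (by omega)]
    push_cast
    ring
  have hsum := HasQDerivAt.sum hterm
  refine (hsum.congr_of_eqOn (g := fun t => jetTransform k (autFactor A t) κ δ (qJet f t) n)
    isOpen_univ (mem_univ τ) fun t _ => ?_).congr_deriv ?_
  · simp only [jetTransform, Finset.mul_sum]
    exact Finset.sum_congr rfl fun j _ => by ring
  · rw [jetTransform]
    simp only [mul_assoc (jetCoeff _ _ _)]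
    rw [jetCoeff_sum_succ, Finset.mul_sum, Finset.mul_sum]
    refine Finset.sum_congr rfl fun j hj => ?_
    obtain ⟨m, rfl⟩ := Nat.exists_eq_add_of_le (Nat.lt_succ_iff.1 (Finset.mem_range.1 hj))
    rw [show 2 * (j + m + 1) - j = 2 * (j + m) - j + 2 by omega,
      show 2 * (j + m + 1) - (j + 1) = 2 * (j + m) - j + 1 by omega,
      show j + m + 1 - (j + 1) = j + m - j by omega]
    field_simp
    ring

theorem qJet_moebius (hA : A.det ≠ 0) (hUo : IsOpen U) (hU : ∀ τ ∈ U, autFactor A τ ≠ 0)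
    (hf : DifferentiableOn ℂ f U) (hg : ∀ τ ∈ U, g (moebius A τ) = autFactor A τ ^ k * f τ)
    (hτ : τ ∈ U) :
    qJet g (moebius A τ) =
      jetTransform k (autFactor A τ) (A 1 0 / (2 * Real.pi * Complex.I)) A.det (qJet f τ) := by
  have hd : (A.det : ℂ) ≠ 0 := by exact_mod_cast hA
  have hgd := differentiableOn_image_moebius hA hU hg hf
  funext n
  induction n generalizing τ with
  | zero => simp [qJet_zero, hg τ hτ, jetTransform, jetCoeff]
  | succ n ih =>
    rw [qJet_succ_moebius hA hUo hU hgd (fun t ht => ih ht) hτ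
      (hasQDerivAt_jetTransform (hU τ hτ) hd (hasQDerivAt_qJet hf hUo hτ) n)]
    have := hU τ hτ
    field_simp

theorem isInvariantODE_of_jetTransform {S : Set (Matrix (Fin 2) (Fin 2) ℝ)} {F : (ℕ → ℂ) → ℂ}
    (hS : ∀ A ∈ S, A.det ≠ 0)
    (hF : ∀ A ∈ S, ∀ J κ : ℂ, J ≠ 0 → ∀ y,
      F (jetTransform k J κ A.det y) = 0 ↔ F y = 0) : IsInvariantODE k S F := by
  intro A hAS U hUo hU f g hg
  have hA := hS A hAS
  have hjet : DifferentiableOn ℂ f U → ∀ τ ∈ U,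
      (F (qJet g (moebius A τ)) = 0 ↔ F (qJet f τ) = 0) := fun hf τ hτ =>
    qJet_moebius hA hUo hU hf hg hτ ▸ hF A hAS _ _ (hU τ hτ) _
  constructor
  · rintro ⟨hf, hode⟩
    refine ⟨differentiableOn_image_moebius hA hU hg hf, ?_⟩
    rintro _ ⟨τ, hτ, rfl⟩
    exact (hjet hf τ hτ).2 (hode τ hτ)
  · rintro ⟨hgd, hode⟩
    have hf := differentiableOn_of_image_moebius hU hg hgd
    exact ⟨hf, fun τ hτ => (hjet hf τ hτ).1 (hode _ (mem_image_of_mem _ hτ))⟩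

section Covariance

variable (J κ : ℂ) (y : ℕ → ℂ)

theorem jetTransform_zero (k : ℤ) (δ : ℂ) : jetTransform k J κ δ y 0 = J ^ k * y 0 := by
  simp [jetTransform, jetCoeff]

theorem jetTransform_one (k : ℤ) (δ : ℂ) :
    jetTransform k J κ δ y 1 = J ^ k / δ * (J ^ 2 * y 1 + k * κ * J * y 0) := by
  simp only [jetTransform, jetCoeff, Finset.sum_range_succ, Finset.prod_range_succ,
    Finset.sum_range_zero, Finset.prod_range_zero, Nat.choose, Nat.reduceAdd, Nat.reduceMul,
    Nat.reduceSub]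
  push_cast
  ring

theorem jetTransform_two (k : ℤ) (δ : ℂ) :
    jetTransform k J κ δ y 2 = J ^ k / δ ^ 2 * (J ^ 4 * y 2 + 2 * (k + 1) * κ * J ^ 3 * y 1
      + k * (k + 1) * κ ^ 2 * J ^ 2 * y 0) := by
  simp only [jetTransform, jetCoeff, Finset.sum_range_succ, Finset.prod_range_succ,
    Finset.sum_range_zero, Finset.prod_range_zero, Nat.choose, Nat.reduceAdd, Nat.reduceMul,
    Nat.reduceSub]
  push_cast
  ring

theorem jetTransform_three (k : ℤ) (δ : ℂ) :
    jetTransform k J κ δ y 3 = J ^ k / δ ^ 3 * (J ^ 6 * y 3 + 3 * (k + 2) * κ * J ^ 5 * y 2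
      + 3 * (k + 1) * (k + 2) * κ ^ 2 * J ^ 4 * y 1
      + k * (k + 1) * (k + 2) * κ ^ 3 * J ^ 3 * y 0) := by
  simp only [jetTransform, jetCoeff, Finset.sum_range_succ, Finset.prod_range_succ,
    Finset.sum_range_zero, Finset.prod_range_zero, Nat.choose, Nat.reduceAdd, Nat.reduceMul,
    Nat.reduceSub]
  push_cast
  ring

theorem jetTransform_four (k : ℤ) (δ : ℂ) :
    jetTransform k J κ δ y 4 = J ^ k / δ ^ 4 * (J ^ 8 * y 4 + 4 * (k + 3) * κ * J ^ 7 * y 3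
      + 6 * (k + 2) * (k + 3) * κ ^ 2 * J ^ 6 * y 2
      + 4 * (k + 1) * (k + 2) * (k + 3) * κ ^ 3 * J ^ 5 * y 1
      + k * (k + 1) * (k + 2) * (k + 3) * κ ^ 4 * J ^ 4 * y 0) := by
  simp only [jetTransform, jetCoeff, Finset.sum_range_succ, Finset.prod_range_succ,
    Finset.sum_range_zero, Finset.prod_range_zero, Nat.choose, Nat.reduceAdd, Nat.reduceMul,
    Nat.reduceSub]
  push_cast
  ring

theorem bracketTwo_jetTransform (k : ℤ) (δ : ℂ) :
    bracketTwo k (jetTransform k J κ δ y) =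
      (J ^ k) ^ 2 * J ^ 4 / δ ^ 2 * bracketTwo k y := by
  rw [bracketTwo, jetTransform_zero, jetTransform_one, jetTransform_two, bracketTwo]
  ring

theorem ode3_jetTransform : ode3 (jetTransform 1 J κ 1 y) = J ^ 16 * ode3 y := by
  rw [ode3, jetTransform_zero, jetTransform_one, jetTransform_two, jetTransform_three, zpow_one,
    ode3]
  push_cast
  ring

theorem ode4_jetTransform (δ : ℂ) :
    ode4 (jetTransform 1 J κ δ y) = J ^ 16 / δ ^ 6 * ode4 y := by
  rw [ode4, jetTransform_zero, jetTransform_one, jetTransform_two, jetTransform_three,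
    jetTransform_four, zpow_one, ode4]
  push_cast
  ring

theorem isInvariantODE_ode3 : IsInvariantODE 1 {A | A.det = 1} ode3 :=
  isInvariantODE_of_jetTransform (fun A hA => hA ▸ one_ne_zero) fun A hA J κ hJ y => by
    rw [show A.det = 1 from hA, Complex.ofReal_one, ode3_jetTransform, mul_eq_zero,
      or_iff_right (pow_ne_zero _ hJ)]

theorem isInvariantODE_ode4 : IsInvariantODE 1 {A | A.det ≠ 0} ode4 :=
  isInvariantODE_of_jetTransform (fun A hA => hA) fun A hA J κ hJ y => by
    have hd : (A.det : ℂ) ≠ 0 := by exact_mod_cast hA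
    rw [ode4_jetTransform, mul_eq_zero,
      or_iff_right (div_ne_zero (pow_ne_zero _ hJ) (pow_ne_zero _ hd))]

end Covariance

end Moebius

section CuspJet

open Function.Periodic (qParam)

variable {F G : ℂ → ℂ} {a b c d : ℂ}

theorem hasQDerivAt_qParam (τ : ℂ) : HasQDerivAt (qParam 1) (qParam 1 τ) τ := by
  have hexp := (((hasDerivAt_id τ).const_mul (2 * Real.pi * Complex.I)).div_const
    ((1 : ℝ) : ℂ)).cexp
  refine hexp.congr_deriv ?_
  rw [qParam, id, Complex.ofReal_one, div_one, div_one, mul_one, mul_comm]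

theorem qParam_mem_ball {τ : ℂ} (hτ : τ ∈ upperHalfPlaneSet) :
    qParam 1 τ ∈ Metric.ball (0 : ℂ) 1 :=
  mem_ball_zero_iff.2 (Function.Periodic.norm_qParam_lt_one one_pos hτ)

theorem exists_qParam_eq {z : ℂ} (hz : z ∈ Metric.ball (0 : ℂ) 1) (h0 : z ≠ 0) :
    ∃ τ ∈ upperHalfPlaneSet, qParam 1 τ = z := by
  have hinv := Function.Periodic.qParam_right_inv one_ne_zero h0
  refine ⟨Function.Periodic.invQParam 1 z, ?_, hinv⟩
  refine (Function.Periodic.norm_qParam_lt_iff one_pos 0 _).1 ?_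
  simpa [hinv] using hz

theorem hasQDerivAt_comp_qParam {Φ : ℂ → ℂ} {τ : ℂ} (h : HasDerivAt Φ a (qParam 1 τ)) :
    HasQDerivAt (fun t => Φ (qParam 1 t)) (qParam 1 τ * a) τ :=
  (HasDerivAt.comp τ h (hasQDerivAt_qParam τ)).congr_deriv (by ring)

/-- `F` is on the upper half-plane a holomorphic function of `q = exp (2πiτ)` in the unit disc,
with expansion `a + b q + O(q²)` at the cusp `q = 0`. -/
def HasCuspJet (F : ℂ → ℂ) (a b : ℂ) : Prop :=
  ∃ Φ : ℂ → ℂ, DifferentiableOn ℂ Φ (Metric.ball 0 1) ∧ Φ 0 = a ∧ HasDerivAt Φ b 0 ∧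
    ∀ τ ∈ upperHalfPlaneSet, F τ = Φ (qParam 1 τ)

theorem HasCuspJet.congr (h : HasCuspJet F a b) (hG : EqOn G F upperHalfPlaneSet) :
    HasCuspJet G a b := by
  obtain ⟨Φ, hΦ, h0, h1, hF⟩ := h
  exact ⟨Φ, hΦ, h0, h1, fun τ hτ => (hG hτ).trans (hF τ hτ)⟩

theorem HasCuspJet.congr_jet (h : HasCuspJet F a b) (ha : a = c) (hb : b = d) :
    HasCuspJet F c d :=
  ha ▸ hb ▸ h

theorem hasCuspJet_const (c : ℂ) : HasCuspJet (fun _ => c) c 0 :=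
  ⟨fun _ => c, differentiableOn_const c, rfl, hasDerivAt_const 0 c, fun _ _ => rfl⟩

theorem hasCuspJet_qParam : HasCuspJet (qParam 1) 0 1 :=
  ⟨id, differentiableOn_id, rfl, hasDerivAt_id 0, fun _ _ => rfl⟩

theorem HasCuspJet.sub (hF : HasCuspJet F a b) (hG : HasCuspJet G c d) :
    HasCuspJet (fun τ => F τ - G τ) (a - c) (b - d) := by
  obtain ⟨Φ, hΦ, rfl, hb, hF⟩ := hF
  obtain ⟨Ψ, hΨ, rfl, hd, hG⟩ := hG
  exact ⟨fun z => Φ z - Ψ z, hΦ.sub hΨ, rfl, hb.sub hd,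
    fun τ hτ => congr_arg₂ (· - ·) (hF τ hτ) (hG τ hτ)⟩

theorem HasCuspJet.add (hF : HasCuspJet F a b) (hG : HasCuspJet G c d) :
    HasCuspJet (fun τ => F τ + G τ) (a + c) (b + d) := by
  obtain ⟨Φ, hΦ, rfl, hb, hF⟩ := hF
  obtain ⟨Ψ, hΨ, rfl, hd, hG⟩ := hG
  exact ⟨fun z => Φ z + Ψ z, hΦ.add hΨ, rfl, hb.add hd,
    fun τ hτ => congr_arg₂ (· + ·) (hF τ hτ) (hG τ hτ)⟩

theorem HasCuspJet.mul (hF : HasCuspJet F a b) (hG : HasCuspJet G c d) :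
    HasCuspJet (fun τ => F τ * G τ) (a * c) (b * c + a * d) := by
  obtain ⟨Φ, hΦ, rfl, hb, hF⟩ := hF
  obtain ⟨Ψ, hΨ, rfl, hd, hG⟩ := hG
  exact ⟨fun z => Φ z * Ψ z, hΦ.mul hΨ, rfl, hb.mul hd,
    fun τ hτ => congr_arg₂ (· * ·) (hF τ hτ) (hG τ hτ)⟩

theorem HasCuspJet.const_mul (hF : HasCuspJet F a b) (c : ℂ) :
    HasCuspJet (fun τ => c * F τ) (c * a) (c * b) :=
  ((hasCuspJet_const c).mul hF).congr_jet rfl (by ring)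

theorem HasCuspJet.pow (hF : HasCuspJet F a b) (n : ℕ) :
    HasCuspJet (fun τ => F τ ^ n) (a ^ n) (n * a ^ (n - 1) * b) := by
  obtain ⟨Φ, hΦ, rfl, hb, hF⟩ := hF
  exact ⟨fun z => Φ z ^ n, hΦ.pow n, rfl, hb.pow n,
    fun τ hτ => congr_arg (· ^ n) (hF τ hτ)⟩

theorem HasCuspJet.div (hF : HasCuspJet F a b) (hG : HasCuspJet G c d) (hc : c ≠ 0)
    (hG0 : ∀ τ ∈ upperHalfPlaneSet, G τ ≠ 0) :
    HasCuspJet (fun τ => F τ / G τ) (a / c) ((b * c - a * d) / c ^ 2) := by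
  obtain ⟨Φ, hΦ, rfl, hb, hF⟩ := hF
  obtain ⟨Ψ, hΨ, rfl, hd, hG⟩ := hG
  refine ⟨fun z => Φ z / Ψ z, hΦ.div hΨ fun z hz => ?_, rfl, hb.div hd hc,
    fun τ hτ => congr_arg₂ (· / ·) (hF τ hτ) (hG τ hτ)⟩
  rcases eq_or_ne z 0 with rfl | h0
  · exact hc
  · obtain ⟨τ, hτ, rfl⟩ := exists_qParam_eq hz h0
    exact hG τ hτ ▸ hG0 τ hτ

theorem HasCuspJet.differentiableOn (h : HasCuspJet F a b) :
    DifferentiableOn ℂ F upperHalfPlaneSet := by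
  obtain ⟨Φ, hΦ, -, -, hF⟩ := h
  exact (hΦ.comp Function.Periodic.differentiable_qParam.differentiableOn
    fun τ hτ => qParam_mem_ball hτ).congr hF

theorem HasCuspJet.div_qParam (h : HasCuspJet F 0 b) :
    ∃ c, HasCuspJet (fun τ => F τ / qParam 1 τ) b c := by
  obtain ⟨Φ, hΦ, h0, hb, hF⟩ := h
  have hball : Metric.ball (0 : ℂ) 1 ∈ 𝓝 0 := Metric.ball_mem_nhds 0 one_pos
  have hslope : DifferentiableOn ℂ (dslope Φ 0) (Metric.ball 0 1) :=
    (Complex.differentiableOn_dslope hball).2 hΦ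
  refine ⟨_, dslope Φ 0, hslope, by rw [dslope_same, hb.deriv],
    (hslope.differentiableAt hball).hasDerivAt, fun τ hτ => ?_⟩
  beta_reduce
  rw [hF τ hτ, dslope_of_ne _ (Function.Periodic.qParam_ne_zero τ), slope_def_field, h0, sub_zero,
    sub_zero]

theorem HasCuspJet.qDeriv_div_qParam
    (h : HasCuspJet (fun τ => (F τ - c) / qParam 1 τ) a b) :
    HasCuspJet (fun τ => qDeriv F τ / qParam 1 τ) a (2 * b) := by
  obtain ⟨Φ, hΦ, h0, hb, hF⟩ := h
  have hball : Metric.ball (0 : ℂ) 1 ∈ 𝓝 0 := Metric.ball_mem_nhds 0 one_pos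
  have hΦ' : DifferentiableOn ℂ (deriv Φ) (Metric.ball 0 1) := hΦ.deriv Metric.isOpen_ball
  refine ⟨fun z => Φ z + z * deriv Φ z, hΦ.add (differentiableOn_id.mul hΦ'), by simp [h0], ?_,
    fun τ hτ => ?_⟩
  · refine (hb.add ((hasDerivAt_id 0).mul
      (hΦ'.differentiableAt hball).hasDerivAt)).congr_deriv ?_
    rw [hb.deriv]
    ring
  · have hFΦ : ∀ t ∈ upperHalfPlaneSet, F t = c + qParam 1 t * Φ (qParam 1 t) := fun t ht => by
      rw [← hF t ht]
      beta_reduce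
      rw [mul_div_cancel₀ _ (Function.Periodic.qParam_ne_zero t)]
      ring
    have hd := (hΦ.differentiableAt
      (Metric.isOpen_ball.mem_nhds (qParam_mem_ball hτ))).hasDerivAt
    have hderiv := (HasQDerivAt.const c τ).add (hasQDerivAt_comp_qParam ((hasDerivAt_id _).mul hd))
    beta_reduce
    rw [(hderiv.congr_of_eqOn UpperHalfPlane.isOpen_upperHalfPlaneSet hτ hFΦ).qDeriv_eq,
      eq_comm, eq_div_iff (Function.Periodic.qParam_ne_zero τ)]
    simp only [id_eq]
    ring

theorem HasCuspJet.exists_ne_zero (h : HasCuspJet F a b) (ha : a ≠ 0) :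
    ∃ τ ∈ upperHalfPlaneSet, F τ ≠ 0 := by
  obtain ⟨Φ, -, rfl, hb, hF⟩ := h
  have hne : ∀ᶠ z in 𝓝[≠] (0 : ℂ), Φ z ≠ 0 ∧ z ∈ Metric.ball (0 : ℂ) 1 :=
    ((hb.continuousAt.eventually_ne ha).and (Metric.ball_mem_nhds 0 one_pos)).filter_mono
      nhdsWithin_le_nhds
  obtain ⟨z, ⟨hz, hball⟩, h0⟩ := (hne.and self_mem_nhdsWithin).exists
  obtain ⟨τ, hτ, rfl⟩ := exists_qParam_eq hball h0
  exact ⟨τ, hτ, hF τ hτ ▸ hz⟩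

end CuspJet

section Fricke

open Function.Periodic (qParam)

/-- The Fricke involution `τ ↦ -1 / (Nτ)` of level `N`. -/
noncomputable def fricke (N : ℝ) (τ : ℂ) : ℂ :=
  -1 / (N * τ)

variable {N : ℝ} {τ : ℂ}

theorem ne_zero_of_mem_upperHalfPlaneSet (hτ : τ ∈ upperHalfPlaneSet) : τ ≠ 0 := by
  have him : 0 < τ.im := hτ
  rintro rfl
  exact him.ne Complex.zero_im.symm

theorem fricke_im (N : ℝ) (τ : ℂ) : (fricke N τ).im = τ.im / (N * Complex.normSq τ) := by
  rw [fricke, neg_div, one_div, mul_inv, ← Complex.ofReal_inv, Complex.neg_im,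
    Complex.im_ofReal_mul, Complex.inv_im]
  ring

theorem fricke_mem_upperHalfPlaneSet (hN : 0 < N) (hτ : τ ∈ upperHalfPlaneSet) :
    fricke N τ ∈ upperHalfPlaneSet := by
  have hnorm := Complex.normSq_pos.2 (ne_zero_of_mem_upperHalfPlaneSet hτ)
  change 0 < (fricke N τ).im
  rw [fricke_im]
  exact div_pos hτ (mul_pos hN hnorm)

/-- A matrix of determinant one that acts as `τ ↦ -1 / (Nτ)`. -/
noncomputable def frickeMatrix (N : ℝ) : Matrix (Fin 2) (Fin 2) ℝ :=
  !![0, -(√N)⁻¹; √N, 0]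

theorem det_frickeMatrix (hN : 0 < N) : (frickeMatrix N).det = 1 := by
  rw [frickeMatrix, Matrix.det_fin_two_of, zero_mul, zero_sub, neg_mul, neg_neg,
    inv_mul_cancel₀ (Real.sqrt_ne_zero'.2 hN)]

theorem autFactor_frickeMatrix (N : ℝ) (τ : ℂ) : autFactor (frickeMatrix N) τ = √N * τ := by
  simp [autFactor, frickeMatrix]

theorem sqrt_ofReal_sq (hN : 0 ≤ N) : (√N : ℂ) ^ 2 = N := by
  rw [← Complex.ofReal_pow, Real.sq_sqrt hN]

theorem moebius_frickeMatrix (hN : 0 ≤ N) (τ : ℂ) : moebius (frickeMatrix N) τ = fricke N τ := by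
  rw [moebius, autFactor_frickeMatrix, fricke, ← sqrt_ofReal_sq hN]
  simp only [frickeMatrix, Matrix.of_apply, Matrix.cons_val', Matrix.cons_val_zero,
    Matrix.cons_val_one, Matrix.cons_val_fin_one]
  push_cast
  ring

theorem qParam_add_intCast (τ : ℂ) (n : ℤ) : qParam 1 (τ + n) = qParam 1 τ := by
  rw [qParam, qParam, Complex.exp_eq_exp_iff_exists_int]
  exact ⟨n, by push_cast; ring⟩

theorem exists_qParam_eq_of_abs_re_le (τ : ℂ) :
    ∃ t : ℂ, qParam 1 t = qParam 1 τ ∧ t.im = τ.im ∧ |t.re| ≤ 1 / 2 := by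
  refine ⟨τ + (-round τ.re : ℤ), qParam_add_intCast τ _, by simp, ?_⟩
  simpa [sub_eq_add_neg] using abs_sub_round τ.re

theorem exists_im_lt_im_fricke (hN : 0 < N) (hτ : τ ∈ upperHalfPlaneSet)
    (h : N * (1 / 4 + τ.im ^ 2) < 1) :
    ∃ t ∈ upperHalfPlaneSet, qParam 1 t = qParam 1 τ ∧ τ.im < (fricke N t).im := by
  obtain ⟨t, hq, him, hre⟩ := exists_qParam_eq_of_abs_re_le τ
  have ht : 0 < t.im := hτ.trans_eq him.symm
  refine ⟨t, ht, hq, ?_⟩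
  have hsq : Complex.normSq t ≤ 1 / 4 + τ.im ^ 2 := by
    rw [Complex.normSq_apply, him]
    nlinarith [abs_le.1 hre]
  have hlt : N * Complex.normSq t < 1 := (mul_le_mul_of_nonneg_left hsq hN.le).trans_lt h
  have hpos := mul_pos hN (Complex.normSq_pos.2 (ne_zero_of_mem_upperHalfPlaneSet ht))
  rw [fricke_im, lt_div_iff₀ hpos, him]
  exact mul_lt_of_lt_one_right hτ hlt

variable {Φ : ℂ → ℂ} {δ : ℝ}

theorem exists_mem_ball_isMaxOn_norm_of_fricke (hN : 0 < N) (hδ : 0 < δ)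
    (hNδ : N * (1 / 4 + δ ^ 2) < 1) (hΦ : DifferentiableOn ℂ Φ (Metric.ball 0 1))
    (h : ∀ τ ∈ upperHalfPlaneSet, ‖Φ (qParam 1 (fricke N τ))‖ = ‖Φ (qParam 1 τ)‖) :
    ∃ w ∈ Metric.ball (0 : ℂ) (Real.exp (-2 * Real.pi * δ)),
      IsMaxOn (norm ∘ Φ) (Metric.ball 0 (Real.exp (-2 * Real.pi * δ))) w := by
  set r := Real.exp (-2 * Real.pi * δ) with hr
  have hr1 : r < 1 := Real.exp_lt_one_iff.2 (by nlinarith [Real.pi_pos])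
  have hlt (t : ℂ) : ‖qParam 1 t‖ < r ↔ δ < t.im := by
    simpa only [div_one] using Function.Periodic.norm_qParam_lt_iff one_pos δ t
  obtain ⟨z, hz, hmax⟩ := (isCompact_closedBall (0 : ℂ) r).exists_isMaxOn
    ⟨0, Metric.mem_closedBall_self (Real.exp_pos _).le⟩
    (hΦ.continuousOn.mono (Metric.closedBall_subset_ball hr1)).norm
  suffices ∃ w ∈ Metric.ball (0 : ℂ) r, ‖Φ w‖ = ‖Φ z‖ by
    obtain ⟨w, hw, hwz⟩ := this
    exact ⟨w, hw, fun u hu => (hmax (Metric.ball_subset_closedBall hu)).trans_eq hwz.symm⟩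
  rcases (mem_closedBall_zero_iff.1 hz).lt_or_eq with hzr | hzr
  · exact ⟨z, mem_ball_zero_iff.2 hzr, rfl⟩
  have hz0 : z ≠ 0 := norm_pos_iff.1 (hzr ▸ Real.exp_pos _)
  obtain ⟨τ, hτ, rfl⟩ := exists_qParam_eq (mem_ball_zero_iff.2 (hzr ▸ hr1)) hz0
  have him : τ.im = δ := by
    rw [Function.Periodic.norm_qParam, div_one, hr, Real.exp_eq_exp] at hzr
    exact mul_left_cancel₀ (mul_ne_zero (by norm_num) Real.pi_ne_zero) hzr
  obtain ⟨t, ht, hqt, htδ⟩ := exists_im_lt_im_fricke hN hτ (him.symm ▸ hNδ)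
  exact ⟨_, mem_ball_zero_iff.2 ((hlt _).2 (him ▸ htδ)), by rw [h t ht, hqt]⟩

theorem HasCuspJet.eq_of_norm_fricke_eq {F : ℂ → ℂ} {a b : ℂ} (hN : 0 < N) (hN4 : N < 4)
    (hF : HasCuspJet F a b) (h : ∀ τ ∈ upperHalfPlaneSet, ‖F (fricke N τ)‖ = ‖F τ‖)
    (hτ : τ ∈ upperHalfPlaneSet) : F τ = a := by
  obtain ⟨Φ, hΦ, rfl, -, hF⟩ := hF
  obtain ⟨δ, ⟨hNδ, hδτ⟩, hδ⟩ : ∃ δ : ℝ, (N * (1 / 4 + δ ^ 2) < 1 ∧ δ < τ.im) ∧ 0 < δ := by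
    have hcont : ContinuousAt (fun δ : ℝ => N * (1 / 4 + δ ^ 2)) 0 := by fun_prop
    have hlt := hcont.eventually_lt_const (show N * (1 / 4 + 0 ^ 2) < 1 by linarith)
    have hsmall : ∀ᶠ δ : ℝ in 𝓝[>] 0, N * (1 / 4 + δ ^ 2) < 1 ∧ δ < τ.im :=
      (hlt.and (gt_mem_nhds hτ)).filter_mono nhdsWithin_le_nhds
    exact (hsmall.and self_mem_nhdsWithin).exists
  set r := Real.exp (-2 * Real.pi * δ)
  have hr1 : r ≤ 1 := Real.exp_le_one_iff.2 (by nlinarith [Real.pi_pos])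
  obtain ⟨w, hw, hmax⟩ := exists_mem_ball_isMaxOn_norm_of_fricke hN hδ hNδ hΦ fun t ht => by
    rw [← hF t ht, ← hF _ (fricke_mem_upperHalfPlaneSet hN ht), h t ht]
  have hconst := Complex.eqOn_of_isPreconnected_of_isMaxOn_norm
    (convex_ball (0 : ℂ) r).isPreconnected Metric.isOpen_ball
    (hΦ.mono (Metric.ball_subset_ball hr1)) hw hmax
  have hqτ : qParam 1 τ ∈ Metric.ball (0 : ℂ) r := by
    simpa [r] using (Function.Periodic.norm_qParam_lt_iff one_pos δ τ).2 hδτ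
  exact (hF τ hτ).trans ((hconst hqτ).trans (hconst (Metric.mem_ball_self (Real.exp_pos _))).symm)

end Fricke

section EtaProduct

open Function.Periodic (qParam)

open ModularForm (eta)

variable {N : ℕ} {τ : ℂ}

/-- `∏ (1 - qⁿ)^24` over `n ≥ 1`, the discriminant `η^24` divided by `q`, as a function of `q`. -/
noncomputable def eulerProd (q : ℂ) : ℂ :=
  ∏' n : ℕ, (1 - q ^ (n + 1)) ^ 24

theorem differentiableOn_eulerProd : DifferentiableOn ℂ eulerProd (Metric.ball 0 1) :=
  ModularForm.differentiableOn_tprod_one_sub_pow_pow 24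

theorem eulerProd_zero : eulerProd 0 = 1 := by
  simp [eulerProd]

theorem eta_pow_eq_qParam_mul_eulerProd (hτ : τ ∈ upperHalfPlaneSet) :
    eta τ ^ 24 = qParam 1 τ * eulerProd (qParam 1 τ) := by
  simpa [ModularForm.discriminant, eulerProd, ModularForm.eta_q] using
    ModularForm.discriminant_eq_q_prod ⟨τ, hτ⟩

theorem eta_pow_neg_one_div (hτ : τ ∈ upperHalfPlaneSet) :
    eta (-1 / τ) ^ 24 = τ ^ 12 * eta τ ^ 24 := by
  have h := ModularForm.eta_comp_eq_csqrt_I_inv hτ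
  simp only [Function.comp_apply, Pi.smul_apply, Pi.mul_apply, smul_eq_mul] at h
  have hsqrt (z : ℂ) : Complex.sqrt z ^ 24 = z ^ 12 := by
    rw [Complex.sqrt, ← Complex.cpow_nat_mul, ← Complex.cpow_natCast z 12]
    norm_num
  have hI : Complex.I ^ 12 = 1 := by
    rw [show 12 = 4 * 3 from rfl, pow_mul, Complex.I_pow_four, one_pow]
  rw [h, mul_pow, mul_pow, inv_pow, hsqrt, hsqrt, hI, inv_one, one_mul]

theorem natCast_mul_mem_upperHalfPlaneSet (hN : 0 < N) (hτ : τ ∈ upperHalfPlaneSet) :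
    N * τ ∈ upperHalfPlaneSet := by
  change 0 < (N * τ).im
  rw [← Complex.ofReal_natCast, Complex.im_ofReal_mul]
  exact mul_pos (Nat.cast_pos.2 hN) hτ

theorem qParam_natCast_mul (N : ℕ) (τ : ℂ) : qParam 1 (N * τ) = qParam 1 τ ^ N := by
  rw [qParam, qParam, ← Complex.exp_nat_mul]
  congr 1
  ring

/-- The weight `24` form `Δ(τ) Δ(Nτ)`, where `Δ = η^24`. It has no zero in the upper half-plane,
and the Fricke involution of level `N` preserves it. -/
noncomputable def etaProduct (N : ℕ) (τ : ℂ) : ℂ :=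
  eta τ ^ 24 * eta (N * τ) ^ 24

theorem etaProduct_ne_zero (hN : 0 < N) (hτ : τ ∈ upperHalfPlaneSet) : etaProduct N τ ≠ 0 :=
  mul_ne_zero (pow_ne_zero 24 (ModularForm.eta_ne_zero hτ))
    (pow_ne_zero 24 (ModularForm.eta_ne_zero (natCast_mul_mem_upperHalfPlaneSet hN hτ)))

theorem etaProduct_fricke (hN : 0 < N) (hτ : τ ∈ upperHalfPlaneSet) :
    etaProduct N (fricke N τ) = N ^ 12 * τ ^ 24 * etaProduct N τ := by
  have hN0 : (N : ℂ) ≠ 0 := Nat.cast_ne_zero.2 hN.ne'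
  have hfricke : fricke N τ = -1 / (N * τ) := by rw [fricke, Complex.ofReal_natCast]
  have hmul : N * fricke N τ = -1 / τ := by rw [hfricke]; field_simp
  rw [etaProduct, etaProduct, hmul, hfricke, eta_pow_neg_one_div hτ,
    eta_pow_neg_one_div (natCast_mul_mem_upperHalfPlaneSet hN hτ)]
  ring

theorem exists_hasCuspJet_etaProduct_div (hN : 0 < N) :
    ∃ b, HasCuspJet (fun τ => etaProduct N τ / qParam 1 τ ^ (N + 1)) 1 b := by
  have hpow : MapsTo (fun z : ℂ => z ^ N) (Metric.ball 0 1) (Metric.ball 0 1) := fun z hz => by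
    rw [mem_ball_zero_iff] at hz ⊢
    rw [norm_pow]
    exact pow_lt_one₀ (norm_nonneg z) hz hN.ne'
  have hdiff : DifferentiableOn ℂ (fun z => eulerProd z * eulerProd (z ^ N)) (Metric.ball 0 1) :=
    differentiableOn_eulerProd.mul
      (differentiableOn_eulerProd.comp (differentiable_pow N).differentiableOn hpow)
  refine ⟨_, _, hdiff, ?_, (hdiff.differentiableAt (Metric.ball_mem_nhds 0 one_pos)).hasDerivAt,
    fun τ hτ => ?_⟩
  · rw [zero_pow hN.ne', eulerProd_zero, one_mul]
  · beta_reduce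
    rw [div_eq_iff (pow_ne_zero _ (Function.Periodic.qParam_ne_zero τ)), etaProduct,
      eta_pow_eq_qParam_mul_eulerProd hτ,
      eta_pow_eq_qParam_mul_eulerProd (natCast_mul_mem_upperHalfPlaneSet hN hτ),
      qParam_natCast_mul]
    ring

end EtaProduct

section EisensteinSeries

open Function.Periodic (qParam)

variable {ι : Type*} {N : ι → ℕ} {τ : ℂ}

theorem differentiableOn_tsum_pow (h : ∀ r ∈ Ioo (0 : ℝ) 1, Summable fun i => r ^ N i) :
    DifferentiableOn ℂ (fun q : ℂ => ∑' i, q ^ N i) (Metric.ball 0 1) := by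
  intro z hz
  obtain ⟨r, hzr, hr1⟩ := exists_between (mem_ball_zero_iff.1 hz)
  have hdiff : DifferentiableOn ℂ (fun q : ℂ => ∑' i, q ^ N i) (Metric.ball 0 r) :=
    Complex.differentiableOn_tsum_of_summable_norm (h r ⟨(norm_nonneg z).trans_lt hzr, hr1⟩)
      (fun i => (differentiable_pow (N i)).differentiableOn) Metric.isOpen_ball fun i w hw => by
        rw [norm_pow]
        exact pow_le_pow_left₀ (norm_nonneg w) (mem_ball_zero_iff.1 hw).le _
  exact (hdiff.differentiableAt
    (Metric.isOpen_ball.mem_nhds (mem_ball_zero_iff.2 hzr))).differentiableWithinAt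

theorem tsum_pow_eq_sum_add {s : Finset ι} {m : ℕ} {q : ℂ} (hs : ∀ i ∉ s, m ≤ N i)
    (h : Summable fun i => q ^ N i) :
    ∑' i, q ^ N i = ∑ i ∈ s, q ^ N i + q ^ m * ∑' i : {i // i ∉ s}, q ^ (N i - m) := by
  rw [← h.sum_add_tsum_subtype_compl s, ← tsum_mul_left]
  congr 1
  exact tsum_congr fun i => by rw [← pow_add, Nat.add_sub_cancel' (hs i i.2)]

theorem summable_pow_sub_of_summable_pow {s : Finset ι} {m : ℕ} {r : ℝ} (hr : r ≠ 0)
    (hs : ∀ i ∉ s, m ≤ N i) (h : Summable fun i => r ^ N i) :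
    Summable fun i : {i // i ∉ s} => r ^ (N i - m) :=
  ((h.subtype _).mul_right (r ^ m)⁻¹).congr fun i => (pow_sub₀ r hr (hs i i.2)).symm

/-- The norm `α² - αβ + β²` on the Eisenstein integers, as a natural number. -/
def eisNorm (p : ℤ × ℤ) : ℕ :=
  (p.1 ^ 2 - p.1 * p.2 + p.2 ^ 2).toNat

theorem eisNorm_cast (p : ℤ × ℤ) : (eisNorm p : ℤ) = p.1 ^ 2 - p.1 * p.2 + p.2 ^ 2 :=
  Int.toNat_of_nonneg (by nlinarith [sq_nonneg (p.1 - p.2), sq_nonneg (p.1 + p.2)])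

theorem qParam_pow_eisNorm (τ : ℂ) (p : ℤ × ℤ) : qParam 1 τ ^ eisNorm p =
    Complex.exp (2 * Real.pi * Complex.I * τ * ((p.1 ^ 2 - p.1 * p.2 + p.2 ^ 2 : ℤ) : ℂ)) := by
  rw [qParam, ← Complex.exp_nat_mul, ← eisNorm_cast, Complex.ofReal_one, div_one,
    Int.cast_natCast, mul_comm]

theorem natAbs_add_natAbs_le_eisNorm (p : ℤ × ℤ) :
    p.1.natAbs + p.2.natAbs ≤ 2 * eisNorm p := by
  zify
  rw [eisNorm_cast]
  have hfst : |p.1| ≤ p.1 ^ 2 := by simpa using Int.natAbs_le_self_sq p.1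
  have hsnd : |p.2| ≤ p.2 ^ 2 := by simpa using Int.natAbs_le_self_sq p.2
  nlinarith [sq_nonneg (p.1 - p.2)]

theorem summable_pow_natAbs {r : ℝ} (h0 : 0 ≤ r) (h1 : r < 1) :
    Summable fun n : ℤ => r ^ n.natAbs := by
  have hgeom := summable_geometric_of_lt_one h0 h1
  exact Summable.of_nat_of_neg (by simpa using hgeom) (by simpa using hgeom)

theorem summable_pow_eisNorm {r : ℝ} (h0 : 0 ≤ r) (h1 : r < 1) :
    Summable fun p => r ^ eisNorm p := by
  have hsqrt : √r < 1 := (Real.sqrt_lt' one_pos).2 (by rwa [one_pow])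
  have hsum := summable_pow_natAbs (Real.sqrt_nonneg r) hsqrt
  refine (hsum.mul_of_nonneg hsum (fun _ => by positivity)
    (fun _ => by positivity)).of_nonneg_of_le (fun _ => by positivity) fun p => ?_
  calc r ^ eisNorm p = √r ^ (2 * eisNorm p) := by rw [pow_mul, Real.sq_sqrt h0]
    _ ≤ √r ^ (p.1.natAbs + p.2.natAbs) :=
      pow_le_pow_of_le_one (Real.sqrt_nonneg r) hsqrt.le (natAbs_add_natAbs_le_eisNorm p)
    _ = √r ^ p.1.natAbs * √r ^ p.2.natAbs := pow_add _ _ _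

theorem summable_qParam_pow_eisNorm (hτ : τ ∈ upperHalfPlaneSet) :
    Summable fun p => qParam 1 τ ^ eisNorm p := by
  refine Summable.of_norm ?_
  simpa only [norm_pow] using summable_pow_eisNorm (norm_nonneg _)
    (mem_ball_zero_iff.1 (qParam_mem_ball hτ))

theorem E13_eq_tsum_qParam (τ : ℂ) : E13 τ = ∑' p, qParam 1 τ ^ eisNorm p := by
  simp only [E13, qParam_pow_eisNorm]

/-- The elements of norm at most `2` of the Eisenstein integers: zero and the six units. -/
def eisShort : Finset (ℤ × ℤ) :=
  {(0, 0), (1, 0), (-1, 0), (0, 1), (0, -1), (1, 1), (-1, -1)}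

theorem three_le_eisNorm {p : ℤ × ℤ} (hp : p ∉ eisShort) : 3 ≤ eisNorm p := by
  contrapose! hp
  have hnorm : p.1 ^ 2 - p.1 * p.2 + p.2 ^ 2 ≤ 2 := by
    rw [← eisNorm_cast]
    omega
  obtain ⟨a, b⟩ := p
  simp only at hnorm
  have ha1 : a ≤ 1 := by nlinarith [sq_nonneg (a - 2 * b)]
  have ha2 : -1 ≤ a := by nlinarith [sq_nonneg (a - 2 * b)]
  have hb1 : b ≤ 1 := by nlinarith [sq_nonneg (b - 2 * a)]
  have hb2 : -1 ≤ b := by nlinarith [sq_nonneg (b - 2 * a)]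
  interval_cases a <;> interval_cases b <;> first | decide | omega

theorem sum_eisShort_pow_eisNorm (q : ℂ) : ∑ p ∈ eisShort, q ^ eisNorm p = 1 + 6 * q := by
  have hunits : q + (q + (q + (q + (q + q)))) = 6 * q := by ring
  simpa [eisShort, eisNorm] using hunits

theorem exists_E13_eq_add_qParam_pow_mul : ∃ T : ℂ → ℂ, DifferentiableOn ℂ T (Metric.ball 0 1) ∧
    ∀ τ ∈ upperHalfPlaneSet, E13 τ = 1 + 6 * qParam 1 τ + qParam 1 τ ^ 3 * T (qParam 1 τ) := by
  have hs : ∀ p ∉ eisShort, 3 ≤ eisNorm p := fun p => three_le_eisNorm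
  refine ⟨_, differentiableOn_tsum_pow fun r hr =>
    summable_pow_sub_of_summable_pow hr.1.ne' hs (summable_pow_eisNorm hr.1.le hr.2),
    fun τ hτ => ?_⟩
  rw [E13_eq_tsum_qParam, tsum_pow_eq_sum_add hs (summable_qParam_pow_eisNorm hτ),
    sum_eisShort_pow_eisNorm]

theorem hasCuspJet_E13_sub_one_div : HasCuspJet (fun τ => (E13 τ - 1) / qParam 1 τ) 6 0 := by
  obtain ⟨T, hT, hE⟩ := exists_E13_eq_add_qParam_pow_mul
  have hT0 := hT.differentiableAt (Metric.ball_mem_nhds (0 : ℂ) one_pos)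
  refine ⟨fun z => 6 + z ^ 2 * T z, by fun_prop, by simp,
    ((((hasDerivAt_id 0).pow 2).mul hT0.hasDerivAt).const_add 6).congr_deriv (by simp),
    fun τ hτ => ?_⟩
  have hq := Function.Periodic.qParam_ne_zero (h := 1) τ
  simp only [hE τ hτ]
  field_simp
  ring

theorem hasCuspJet_E13 : HasCuspJet E13 1 6 := by
  refine (((hasCuspJet_const 1).add
    (hasCuspJet_qParam.mul hasCuspJet_E13_sub_one_div)).congr_jet (by ring)
    (by ring)).congr fun τ _ => ?_
  beta_reduce
  rw [mul_div_cancel₀ _ (Function.Periodic.qParam_ne_zero τ), add_sub_cancel]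

end EisensteinSeries

section LatticePoisson

open Function.Periodic (qParam)

variable {τ : ℂ}

theorem ofReal_mul_cpow {r : ℝ} (hr : 0 < r) {w : ℂ} (hw : w ≠ 0) (s : ℂ) :
    (r * w) ^ s = (r : ℂ) ^ s * w ^ s := by
  have hr0 : (r : ℂ) ≠ 0 := Complex.ofReal_ne_zero.2 hr.ne'
  rw [Complex.cpow_def_of_ne_zero (mul_ne_zero hr0 hw), Complex.cpow_def_of_ne_zero hr0,
    Complex.cpow_def_of_ne_zero hw, Complex.log_ofReal_mul hr hw, Complex.ofReal_log hr.le,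
    add_mul, Complex.exp_add]

theorem ofReal_mul_cpow_half_mul_ofReal_mul_cpow_half {a b : ℝ} (ha : 0 < a) (hb : 0 < b) {w : ℂ}
    (hw : w ≠ 0) :
    (a * w) ^ (1 / 2 : ℂ) * (b * w) ^ (1 / 2 : ℂ) = √(a * b) * w := by
  have hab : ((a : ℂ) * b) ^ (1 / 2 : ℂ) = √(a * b) := by
    rw [Real.sqrt_eq_rpow, Complex.ofReal_cpow (mul_pos ha hb).le]
    push_cast
    rfl
  rw [ofReal_mul_cpow ha hw, ofReal_mul_cpow hb hw, mul_mul_mul_comm,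
    ← Complex.mul_cpow_ofReal_nonneg ha.le hb.le, hab, ← Complex.cpow_add _ _ hw,
    add_halves, Complex.cpow_one]

/-- The summand of the double series that Poisson summation over one variable makes of `E13 τ`,
and over the other variable of `E13 (-1 / (3τ))`. -/
noncomputable def thetaKernel (τ : ℂ) (b m : ℤ) : ℂ :=
  Complex.exp (Real.pi * Complex.I * (3 / 2 * τ) * b ^ 2 - Real.pi * Complex.I * m * b
    - Real.pi * Complex.I * m ^ 2 / (2 * τ))

theorem thetaKernel_eq_jacobiTheta₂_term_mul (τ : ℂ) (b m : ℤ) :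
    thetaKernel τ b m = jacobiTheta₂_term b 0 (3 / 2 * τ) * jacobiTheta₂_term m 0 (fricke 2 τ) *
      Complex.exp ((-Real.pi * m * b : ℝ) * Complex.I) := by
  rw [thetaKernel, jacobiTheta₂_term, jacobiTheta₂_term, ← Complex.exp_add, ← Complex.exp_add,
    fricke]
  congr 1
  push_cast
  ring

theorem summable_thetaKernel (hτ : τ ∈ upperHalfPlaneSet) :
    Summable (Function.uncurry (thetaKernel τ)) := by
  have hτ' : 0 < (3 / 2 * τ).im := by simpa using hτ
  have hb := ((summable_jacobiTheta₂_term_iff 0 _).2 hτ').norm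
  have hm := ((summable_jacobiTheta₂_term_iff 0 _).2
    (fricke_mem_upperHalfPlaneSet two_pos hτ)).norm
  refine Summable.of_norm ((hb.mul_of_nonneg hm (fun _ => norm_nonneg _)
    fun _ => norm_nonneg _).congr fun p => ?_)
  rw [Function.uncurry, thetaKernel_eq_jacobiTheta₂_term_mul, norm_mul, norm_mul,
    Complex.norm_exp_ofReal_mul_I, mul_one]

theorem tsum_qParam_pow_eisNorm_eq (hτ : τ ≠ 0) (b : ℤ) :
    ∑' a, qParam 1 τ ^ eisNorm (b, a) =
      1 / (-Complex.I * (2 * τ)) ^ (1 / 2 : ℂ) * ∑' m, thetaKernel τ b m := by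
  have htheta : ∑' a, qParam 1 τ ^ eisNorm (b, a) =
      Complex.exp (2 * Real.pi * Complex.I * τ * b ^ 2) * jacobiTheta₂ (-b * τ) (2 * τ) := by
    rw [jacobiTheta₂, ← tsum_mul_left]
    refine tsum_congr fun a => ?_
    rw [qParam_pow_eisNorm, jacobiTheta₂_term, ← Complex.exp_add]
    congr 1
    push_cast
    ring
  rw [htheta, jacobiTheta₂_functional_equation, mul_assoc (1 / _), mul_left_comm _ (1 / _)]
  congr 1
  rw [jacobiTheta₂, ← tsum_mul_left, ← tsum_mul_left]
  refine tsum_congr fun m => ?_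
  rw [jacobiTheta₂_term, thetaKernel, ← Complex.exp_add, ← Complex.exp_add]
  congr 1
  field_simp
  ring

theorem tsum_thetaKernel_eq (hτ : τ ≠ 0) (m : ℤ) :
    ∑' b, thetaKernel τ b m = 1 / (-Complex.I * (3 / 2 * τ)) ^ (1 / 2 : ℂ) *
      ∑' n, qParam 1 (fricke 3 τ) ^ eisNorm (m, n) := by
  have htheta : ∑' b, thetaKernel τ b m =
      Complex.exp (-Real.pi * Complex.I * m ^ 2 / (2 * τ)) *
        jacobiTheta₂ (-m / 2) (3 / 2 * τ) := by
    rw [jacobiTheta₂, ← tsum_mul_left]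
    refine tsum_congr fun b => ?_
    rw [thetaKernel, jacobiTheta₂_term, ← Complex.exp_add]
    congr 1
    ring
  rw [htheta, jacobiTheta₂_functional_equation, mul_assoc (1 / _), mul_left_comm _ (1 / _)]
  congr 1
  rw [jacobiTheta₂, ← (Equiv.neg ℤ).tsum_eq, ← tsum_mul_left, ← tsum_mul_left]
  refine tsum_congr fun n => ?_
  rw [qParam_pow_eisNorm, jacobiTheta₂_term, ← Complex.exp_add, ← Complex.exp_add,
    Equiv.neg_apply, fricke]
  congr 1
  push_cast
  field_simp
  ring

theorem E13_fricke (hτ : τ ∈ upperHalfPlaneSet) :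
    E13 (fricke 3 τ) = √3 * τ * (-Complex.I * E13 τ) := by
  have hτ0 := ne_zero_of_mem_upperHalfPlaneSet hτ
  have hw : -Complex.I * τ ≠ 0 := mul_ne_zero (neg_ne_zero.2 Complex.I_ne_zero) hτ0
  have hroots : (-Complex.I * (2 * τ)) ^ (1 / 2 : ℂ) * (-Complex.I * (3 / 2 * τ)) ^ (1 / 2 : ℂ) =
      √3 * (-Complex.I * τ) := by
    have h := ofReal_mul_cpow_half_mul_ofReal_mul_cpow_half two_pos
      (show (0 : ℝ) < 3 / 2 by norm_num) hw
    rw [show (2 : ℝ) * (3 / 2) = 3 by norm_num] at h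
    push_cast at h
    rw [← h, mul_left_comm 2, mul_left_comm (3 / 2)]
  have hE : E13 τ = 1 / (√3 * (-Complex.I * τ)) * E13 (fricke 3 τ) := by
    rw [E13_eq_tsum_qParam, E13_eq_tsum_qParam, (summable_qParam_pow_eisNorm hτ).tsum_prod,
      (summable_qParam_pow_eisNorm (fricke_mem_upperHalfPlaneSet three_pos hτ)).tsum_prod,
      tsum_congr (tsum_qParam_pow_eisNorm_eq hτ0), tsum_mul_left,
      ← (summable_thetaKernel hτ).tsum_comm, tsum_congr (tsum_thetaKernel_eq hτ0),
      tsum_mul_left, ← mul_assoc, one_div_mul_one_div, hroots]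
  have hsqrt : (√3 : ℂ) ≠ 0 := Complex.ofReal_ne_zero.2 (Real.sqrt_ne_zero'.2 three_pos)
  rw [hE]
  field_simp

end LatticePoisson

section CubicTheta

open Function.Periodic (qParam)

variable {τ : ℂ}

theorem HasCuspJet.qJet_succ_div_qParam {F : ℂ → ℂ} {a b c : ℂ}
    (h : HasCuspJet (fun τ => (F τ - c) / qParam 1 τ) a b) (n : ℕ) :
    HasCuspJet (fun τ => qJet F τ (n + 1) / qParam 1 τ) a (2 ^ (n + 1) * b) := by
  induction n with
  | zero => exact h.qDeriv_div_qParam.congr_jet rfl (by ring)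
  | succ n ih =>
    simp only [qJet_succ F _ (n + 1)]
    have ih' : HasCuspJet (fun τ => (qJet F τ (n + 1) - 0) / qParam 1 τ) a (2 ^ (n + 1) * b) := by
      simpa only [sub_zero] using ih
    exact ih'.qDeriv_div_qParam.congr_jet rfl (by ring)

theorem hasCuspJet_qJet_succ_E13_div (n : ℕ) :
    HasCuspJet (fun τ => qJet E13 τ (n + 1) / qParam 1 τ) 6 0 :=
  (hasCuspJet_E13_sub_one_div.qJet_succ_div_qParam n).congr_jet rfl (mul_zero _)

theorem differentiableOn_E13 : DifferentiableOn ℂ E13 upperHalfPlaneSet :=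
  hasCuspJet_E13.differentiableOn

theorem isPreconnected_upperHalfPlaneSet : IsPreconnected upperHalfPlaneSet :=
  (convex_halfSpace_im_gt 0).isPreconnected

theorem hasCuspJet_bracketTwo_E13_div :
    HasCuspJet (fun τ => bracketTwo 1 (qJet E13 τ) / qParam 1 τ) 6 (-36) := by
  have h1 := hasCuspJet_qJet_succ_E13_div 0
  have h2 := hasCuspJet_qJet_succ_E13_div 1
  refine (((hasCuspJet_E13.mul h2).sub (hasCuspJet_qParam.mul ((h1.pow 2).const_mul 2))).congr
    fun τ _ => ?_).congr_jet (by norm_num) (by norm_num)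
  have hq := Function.Periodic.qParam_ne_zero (h := 1) τ
  simp only [bracketTwo, qJet_zero]
  field_simp
  ring

theorem exists_hasCuspJet_bracketThree_E13_div :
    ∃ b, HasCuspJet (fun τ => bracketThree 1 (qJet E13 τ) / qParam 1 τ) 6 b := by
  have h1 := hasCuspJet_qJet_succ_E13_div 0
  have h2 := hasCuspJet_qJet_succ_E13_div 1
  have h3 := hasCuspJet_qJet_succ_E13_div 2
  refine ⟨_, (((((hasCuspJet_E13.pow 2).mul h3).sub
    (hasCuspJet_qParam.mul (((hasCuspJet_E13.mul h1).mul h2).const_mul 9))).add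
    ((hasCuspJet_qParam.pow 2).mul ((h1.pow 3).const_mul 12))).congr
    fun τ _ => ?_).congr_jet (by norm_num) rfl⟩
  have hq := Function.Periodic.qParam_ne_zero (h := 1) τ
  simp only [bracketThree, qJet_zero]
  field_simp
  ring

theorem hasCuspJet_ode3_E13_div_sq :
    HasCuspJet (fun τ => ode3 (qJet E13 τ) / qParam 1 τ ^ 2) 0 0 := by
  have h0 := hasCuspJet_E13
  have h1 := hasCuspJet_qJet_succ_E13_div 0
  have h2 := hasCuspJet_qJet_succ_E13_div 1
  have h3 := hasCuspJet_qJet_succ_E13_div 2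
  have hq := hasCuspJet_qParam
  refine ((((((((h0.pow 2).mul (h3.pow 2)).sub
    ((hq.mul (h1.mul (((h0.mul h2).const_mul 3).sub
      (hq.mul ((h1.pow 2).const_mul 4))))).mul (h3.const_mul 6))).add
    (hq.mul ((h0.mul (h2.pow 3)).const_mul 18))).sub
    (((h0.pow 6).add ((hq.mul h1).pow 2 |>.const_mul 27)).mul (h2.pow 2))).add
    (hq.mul (((h0.pow 5).mul ((h1.pow 2).mul h2)).const_mul 4))).sub
    ((hq.pow 2).mul (((h0.pow 4).mul (h1.pow 4)).const_mul 4))).congr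
    fun τ _ => ?_).congr_jet (by norm_num) (by norm_num)
  have hq := Function.Periodic.qParam_ne_zero (h := 1) τ
  simp only [ode3, qJet_zero]
  field_simp

theorem exists_hasCuspJet_ode3_E13_div_cube :
    ∃ b, HasCuspJet (fun τ => ode3 (qJet E13 τ) / qParam 1 τ ^ 3) 0 b := by
  obtain ⟨b, hb⟩ := hasCuspJet_ode3_E13_div_sq.div_qParam
  exact ⟨b, hb.congr fun τ _ => by simp only [div_div, ← pow_succ]⟩

theorem qJet_E13_fricke (hτ : τ ∈ upperHalfPlaneSet) :
    qJet E13 (fricke 3 τ) = jetTransform 1 (√3 * τ) (frickeMatrix 3 1 0 / (2 * Real.pi * Complex.I))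
      1 (fun n => -Complex.I * qJet E13 τ n) := by
  have hUo := UpperHalfPlane.isOpen_upperHalfPlaneSet
  have hsqrt : (√3 : ℂ) ≠ 0 := Complex.ofReal_ne_zero.2 (Real.sqrt_ne_zero'.2 three_pos)
  have hdet := det_frickeMatrix three_pos
  have hJ := qJet_moebius (k := 1) (hdet.symm ▸ one_ne_zero) hUo
    (fun t ht => autFactor_frickeMatrix 3 t ▸
      mul_ne_zero hsqrt (ne_zero_of_mem_upperHalfPlaneSet ht))
    (differentiableOn_E13.const_mul (-Complex.I)) (g := E13)
    (fun t ht => by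
      rw [moebius_frickeMatrix zero_le_three, autFactor_frickeMatrix, E13_fricke ht, zpow_one]) hτ
  rw [moebius_frickeMatrix zero_le_three, autFactor_frickeMatrix, hdet] at hJ
  rw [hJ, Complex.ofReal_one]
  congr 1
  exact funext fun n => qJet_const_mul hUo differentiableOn_E13 _ n hτ

theorem bracketTwo_E13_fricke (hτ : τ ∈ upperHalfPlaneSet) :
    bracketTwo 1 (qJet E13 (fricke 3 τ)) = -(√3 * τ) ^ 6 * bracketTwo 1 (qJet E13 τ) := by
  have hB := bracketTwo_jetTransform (√3 * τ)
    (frickeMatrix 3 1 0 / (2 * Real.pi * Complex.I)) (fun n => -Complex.I * qJet E13 τ n) 1 1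
  rw [Int.cast_one] at hB
  rw [qJet_E13_fricke hτ, hB]
  simp only [bracketTwo, zpow_one]
  linear_combination (√3 * τ) ^ 6 * (qJet E13 τ 0 * qJet E13 τ 2 - 2 * qJet E13 τ 1 ^ 2) *
    Complex.I_sq

theorem ode3_E13_fricke (hτ : τ ∈ upperHalfPlaneSet) :
    ode3 (qJet E13 (fricke 3 τ)) = (√3 * τ) ^ 16 * ode3 (qJet E13 τ) := by
  rw [qJet_E13_fricke hτ, ode3_jetTransform, ode3_const_mul]
  rw [neg_pow, Complex.I_pow_four]
  norm_num

theorem bracketTwo_E13_ne_zero (hτ : τ ∈ upperHalfPlaneSet) : bracketTwo 1 (qJet E13 τ) ≠ 0 := by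
  obtain ⟨b, hη⟩ := exists_hasCuspJet_etaProduct_div three_pos
  have hη0 (t : ℂ) (ht : t ∈ upperHalfPlaneSet) : etaProduct 3 t ≠ 0 :=
    etaProduct_ne_zero three_pos ht
  have hjet := (hasCuspJet_bracketTwo_E13_div.pow 4).div hη one_ne_zero fun t ht =>
    div_ne_zero (hη0 t ht) (pow_ne_zero _ (Function.Periodic.qParam_ne_zero t))
  have hF : EqOn (fun t => bracketTwo 1 (qJet E13 t) ^ 4 / etaProduct 3 t) (fun t =>
      (bracketTwo 1 (qJet E13 t) / qParam 1 t) ^ 4 / (etaProduct 3 t / qParam 1 t ^ (3 + 1)))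
      upperHalfPlaneSet := fun t _ => by
    have hq := Function.Periodic.qParam_ne_zero (h := 1) t
    field_simp
  have hsqrt : (√3 : ℂ) ^ 24 = 3 ^ 12 := by
    rw [pow_mul _ 2 12, sqrt_ofReal_sq zero_le_three, Complex.ofReal_ofNat]
  have hinv (t : ℂ) (ht : t ∈ upperHalfPlaneSet) :
      bracketTwo 1 (qJet E13 (fricke 3 t)) ^ 4 / etaProduct 3 (fricke 3 t) =
        bracketTwo 1 (qJet E13 t) ^ 4 / etaProduct 3 t := by
    have hη' := etaProduct_fricke three_pos ht
    rw [Nat.cast_ofNat, Nat.cast_ofNat] at hη'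
    have ht0 := ne_zero_of_mem_upperHalfPlaneSet ht
    rw [bracketTwo_E13_fricke ht, hη', div_eq_div_iff (by simp [ht0, hη0 t ht]) (hη0 t ht)]
    linear_combination t ^ 24 * bracketTwo 1 (qJet E13 t) ^ 4 * etaProduct 3 t * hsqrt
  have hconst := (hjet.congr hF).eq_of_norm_fricke_eq three_pos (by norm_num)
    (fun t ht => congr_arg norm (hinv t ht)) hτ
  intro h0
  norm_num [h0] at hconst

theorem sq_mul_ode3_E13_eq_zero (hτ : τ ∈ upperHalfPlaneSet) :
    E13 τ ^ 2 * ode3 (qJet E13 τ) = 0 := by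
  obtain ⟨b, hode⟩ := exists_hasCuspJet_ode3_E13_div_cube
  have hB0 (t : ℂ) (ht : t ∈ upperHalfPlaneSet) := bracketTwo_E13_ne_zero ht
  have hjet := ((hasCuspJet_E13.pow 2).mul hode).div (hasCuspJet_bracketTwo_E13_div.pow 3)
    (by norm_num) fun t ht =>
      pow_ne_zero _ (div_ne_zero (hB0 t ht) (Function.Periodic.qParam_ne_zero t))
  have hF : EqOn (fun t => E13 t ^ 2 * ode3 (qJet E13 t) / bracketTwo 1 (qJet E13 t) ^ 3)
      (fun t => E13 t ^ 2 * (ode3 (qJet E13 t) / qParam 1 t ^ 3) /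
        (bracketTwo 1 (qJet E13 t) / qParam 1 t) ^ 3) upperHalfPlaneSet := fun t _ => by
    have hq := Function.Periodic.qParam_ne_zero (h := 1) t
    field_simp
  have hinv (t : ℂ) (ht : t ∈ upperHalfPlaneSet) :
      E13 (fricke 3 t) ^ 2 * ode3 (qJet E13 (fricke 3 t)) /
          bracketTwo 1 (qJet E13 (fricke 3 t)) ^ 3 =
        E13 t ^ 2 * ode3 (qJet E13 t) / bracketTwo 1 (qJet E13 t) ^ 3 := by
    rw [div_eq_div_iff (pow_ne_zero _ (hB0 _ (fricke_mem_upperHalfPlaneSet three_pos ht)))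
      (pow_ne_zero _ (hB0 t ht)), E13_fricke ht, ode3_E13_fricke ht, bracketTwo_E13_fricke ht]
    linear_combination (√3 * t) ^ 18 * E13 t ^ 2 * ode3 (qJet E13 t) *
      bracketTwo 1 (qJet E13 t) ^ 3 * Complex.I_sq
  have hconst := (hjet.congr hF).eq_of_norm_fricke_eq three_pos (by norm_num)
    (fun t ht => congr_arg norm (hinv t ht)) hτ
  simpa [hB0 τ hτ] using hconst

theorem isSolutionOn_ode3_E13 : IsSolutionOn ode3 E13 upperHalfPlaneSet := by
  refine ⟨differentiableOn_E13, fun τ hτ => ?_⟩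
  have hdiff := hasCuspJet_ode3_E13_div_sq.differentiableOn
  have hprod (t : ℂ) (ht : t ∈ upperHalfPlaneSet) :
      E13 t ^ 2 * (ode3 (qJet E13 t) / qParam 1 t ^ 2) = 0 := by
    rw [mul_div_assoc', sq_mul_ode3_E13_eq_zero ht, zero_div]
  rcases eqOn_zero_or_eqOn_zero_of_mul UpperHalfPlane.isOpen_upperHalfPlaneSet
    isPreconnected_upperHalfPlaneSet (differentiableOn_E13.pow 2) hdiff hprod with h | h
  · obtain ⟨t, ht, h0⟩ := hasCuspJet_E13.exists_ne_zero one_ne_zero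
    exact absurd (h t ht) (pow_ne_zero 2 h0)
  · exact (div_eq_zero_iff.1 (h τ hτ)).resolve_right
      (pow_ne_zero 2 (Function.Periodic.qParam_ne_zero τ))

theorem exists_isHuberSolutionOn_E13 :
    ∃ M N : ℂ → ℂ, IsHuberSolutionOn E13 M N upperHalfPlaneSet := by
  obtain ⟨b, hC⟩ := exists_hasCuspJet_bracketThree_E13_div
  obtain ⟨τ, hτ, h⟩ := hC.exists_ne_zero (by norm_num)
  exact ⟨_, _, isSolutionOn_ode3_E13.isHuberSolutionOn UpperHalfPlane.isOpen_upperHalfPlaneSet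
    isPreconnected_upperHalfPlaneSet (fun t ht => bracketTwo_E13_ne_zero ht)
    ⟨τ, hτ, (div_ne_zero_iff.1 h).1⟩⟩

theorem exists_invI_E13_ne :
    ∃ τ ∈ upperHalfPlaneSet, E13 τ ≠ 0 ∧ invI 1 (qJet E13 τ) ≠ 1 / 18 := by
  have hjet := hasCuspJet_E13.mul ((hasCuspJet_E13.pow 6).sub
    (hasCuspJet_qParam.mul (hasCuspJet_bracketTwo_E13_div.const_mul 18)))
  obtain ⟨τ, hτ, h⟩ := hjet.exists_ne_zero (by norm_num)
  obtain ⟨hE, hI⟩ := mul_ne_zero_iff.1 h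
  refine ⟨τ, hτ, hE, fun heq => hI ?_⟩
  rw [invI_one, qJet_zero, div_eq_iff (pow_ne_zero 6 hE)] at heq
  rw [mul_left_comm, mul_div_cancel₀ _ (Function.Periodic.qParam_ne_zero τ), heq]
  ring

theorem isSolutionOn_ode4_E13 : IsSolutionOn ode4 E13 upperHalfPlaneSet :=
  isSolutionOn_ode3_E13.ode4_of_ode3 UpperHalfPlane.isOpen_upperHalfPlaneSet
    isPreconnected_upperHalfPlaneSet exists_invI_E13_ne

end CubicTheta

theorem mainTheorem8 :
    -- the series converges on the upper half-plane, and it solves Huber's system for some `M`, `N`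
    (∀ τ ∈ upperHalfPlaneSet, Summable fun p : ℤ × ℤ =>
      Complex.exp (2 * Real.pi * Complex.I * τ * ((p.1 ^ 2 - p.1 * p.2 + p.2 ^ 2 : ℤ) : ℂ))) ∧
    (∃ M N : ℂ → ℂ, IsHuberSolutionOn E13 M N upperHalfPlaneSet) ∧
    -- elimination of `M` and `N` from Huber's system
    (∀ (U : Set ℂ) (f M N : ℂ → ℂ), IsOpen U → IsHuberSolutionOn f M N U →
      IsSolutionOn ode3 f U) ∧
    -- the third-order ODE: it holds for `E13`, is invariant, and has the stated invariant form
    IsSolutionOn ode3 E13 upperHalfPlaneSet ∧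
    IsInvariantODE 1 {A | A.det = 1} ode3 ∧
    (∀ y : ℕ → ℂ, y 0 ≠ 0 →
      (ode3 y = 0 ↔ invJ 1 y ^ 2 + 18 * invI 1 y ^ 3 - invI 1 y ^ 2 = 0)) ∧
    (∀ τ ∈ upperHalfPlaneSet, E13 τ ≠ 0 →
      invJ 1 (qJet E13 τ) ^ 2 + 18 * invI 1 (qJet E13 τ) ^ 3 - invI 1 (qJet E13 τ) ^ 2 = 0) ∧
    -- the fourth-order ODE is a differential consequence of the third-order one
    (∀ (U : Set ℂ) (f : ℂ → ℂ), IsOpen U → IsPreconnected U → IsSolutionOn ode3 f U →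
      (∃ τ ∈ U, f τ ≠ 0 ∧ invI 1 (qJet f τ) ≠ 1 / 18) → IsSolutionOn ode4 f U) ∧
    -- the fourth-order ODE: it holds for `E13`, is invariant, and has the stated invariant form
    IsSolutionOn ode4 E13 upperHalfPlaneSet ∧
    IsInvariantODE 1 {A | A.det ≠ 0} ode4 ∧
    (∀ y : ℕ → ℂ, y 0 ≠ 0 → bracketTwo 1 y ≠ 0 →
      (ode4 y = 0 ↔ invQ 1 y - 2 * invP 1 y - 36 = 0)) ∧
    (∀ τ ∈ upperHalfPlaneSet, bracketTwo 1 (qJet E13 τ) ≠ 0 ∧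
      invQ 1 (qJet E13 τ) - 2 * invP 1 (qJet E13 τ) - 36 = 0) := by
  have h3 := isSolutionOn_ode3_E13
  have h4 := isSolutionOn_ode4_E13
  refine ⟨fun τ hτ => ?_, exists_isHuberSolutionOn_E13,
    fun U f M N hU h => h.isSolutionOn_ode3 hU, h3, isInvariantODE_ode3,
    fun y hy => ode3_eq_zero_iff_invariants hy,
    fun τ hτ hne => (ode3_eq_zero_iff_invariants hne).1 (h3.2 τ hτ),
    fun U f hU hc h hns => h.ode4_of_ode3 hU hc hns, h4, isInvariantODE_ode4,
    fun y hy hB => ode4_eq_zero_iff_invariants hy hB,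
    fun τ hτ => ⟨bracketTwo_E13_ne_zero hτ,
      invQ_sub_invP_eq_zero (bracketTwo_E13_ne_zero hτ) (h4.2 τ hτ)⟩⟩
  simpa only [qParam_pow_eisNorm] using summable_qParam_pow_eisNorm hτ
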